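/- \textbf{Theorem ($gl_2$ theorem).} Work over $\mathbb{C}$ with Zariski topologies. For $w,r\ge 0$ let $O_{(w-r,r)}=\{t\in\mathrm{End}(\mathbb{C}^w): t^2=0,\ \mathrm{rank}\,t=r\}$. For $t\in O_{(w-r,r)}$ let $\mathfrak{M}_2(w,r)$ be the variety of subspaces $F\subset\mathbb{C}^w$ with $\mathrm{im}\,t\subset F\subset\ker t$, and let $\mathfrak{M}_2(v,w,r)$ be its part with $\dim F=v$ (if $O_{(w-r,r)}=\emptyset$, these are empty). The irreducible components of $\mathfrak{M}_2(w,r)$ are exactly the $\mathfrak{M}_2(v,w,r)$ with $r\le v\le w-r$, all nonempty. Their set $\mathcal{M}_2(w,r)$ is a normal $gl_2$-crystal with $$wt=(v,w-v),\quad \varepsilon=w-r-v,\quad \varphi=v-r,\quad \tilde e\,\mathfrak{M}_2(v,w,r)=\mathfrak{M}_2(v+1,w,r),\quad \tilde f\,\mathfrak{M}_2(v,w,r)=\mathfrak{M}_2(v-1,w,r),$$ where the value of $\tilde e$ (resp. $\tilde f$) is $0$ if $v\ge w-r$ (resp. $v\le r$). The tensor product $\mathcal{A}\otimes\mathcal{B}$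 of crystals is $\mathcal{A}\times\mathcal{B}$ with $wt(a,b)=wt(a)+wt(b)$, $\varepsilon(a,b)=\max\{\varepsilon(a),\varepsilon(a)+\varepsilon(b)-\varphi(a)\}$, $\varphi(a,b)=\max\{\varphi(b),\varphi(a)+\varphi(b)-\varepsilon(b)\}$, $\tilde e(a,b)=(\tilde e a,b)$ if $\varphi(a)\ge\varepsilon(b)$ and $(a,\tilde e b)$ otherwise, $\tilde f(a,b)=(\tilde f a,b)$ if $\varphi(a)>\varepsilon(b)$ and $(a,\tilde f b)$ otherwise. A direct sum of crystals is their disjoint union. Let $w^1,r^1,w^2,r^2\ge 0$ and $w=w^1+w^2$. For a subspace $X\subset\mathbb{C}^w$ and $t\in\mathrm{End}(\mathbb{C}^w)$ consider the condition $$(*)\qquad \dim X=w^1,\quad tX\subset X,\quad \mathrm{rank}(t|_X)=r^1,\quad \mathrm{rank}(t|_{\mathbb{C}^w/X})=r^2 .$$ For $t\in O_{(w-r,r)}$ let $\mathfrak{S}_2(r)=\mathfrak{S}_2(((w^1,r^1),(w^2,r^2)),(w,r))$ be the variety of all $X$ satisfying $(*)$ (empty if $O_{(w-r,r)}=\emptyset$),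 and let $\mathcal{S}_2(r)$ be the set of its irreducible components, considered as a trivial crystal. Then $\mathcal{S}_2(r)=\{\mathfrak{S}_2(r)\}$ if $r^1+r^2\le r\le\min(w^2-r^2+r^1,\,w^1-r^1+r^2)$, and $\mathcal{S}_2(r)=\emptyset$ otherwise. Let $\mathfrak{T}_2$ be the variety of triples $(t,X,F)$ with $t\in\mathrm{End}(\mathbb{C}^w)$, $t^2=0$, $F\subset\mathbb{C}^w$ a subspace with $\mathrm{im}\,t\subset F\subset\ker t$, and $X$ satisfying $(*)$. Let $\mathcal{T}_2$ be the set of its irreducible components. Then there are bijections $$\alpha:\mathcal{M}_2(w^1,r^1)\times\mathcal{M}_2(w^2,r^2)\to\mathcal{T}_2,\qquad \beta:\bigsqcup_{r\ge0}\mathcal{S}_2(r)\times\mathcal{M}_2(w,r)\to\mathcal{T}_2,$$ where $\alpha(\mathfrak{M}_2(v^1,w^1,r^1),\mathfrak{M}_2(v^2,w^2,r^2))$ is the closure in $\mathfrak{T}_2$ of the set of triples with $\dim(F\cap X)=v^1$ and $\dim F/(F\cap X)=v^2$, and $\beta(\mathfrak{S}_2(r),\mathfrak{M}_2(v,w,r))$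 is the closure in $\mathfrak{T}_2$ of the set of triples with $\dim F=v$ and $\mathrm{rank}\,t=r$. The bijection $\tau_2=\beta^{-1}\circ\alpha$ is given by $$\tau_2\bigl(\mathfrak{M}_2(v^1,w^1,r^1),\mathfrak{M}_2(v^2,w^2,r^2)\bigr)=\bigl(\mathfrak{S}_2(r_0),\ \mathfrak{M}_2(v^1+v^2,w,r_0)\bigr),\qquad r_0=\min(w^2-v^2+r^1,\ v^1+r^2),$$ and it is an isomorphism of (normal) $gl_2$-crystals $$\mathcal{M}_2(w^1,r^1)\otimes\mathcal{M}_2(w^2,r^2)\ \cong\ \bigoplus_{r\ge0}\mathcal{S}_2\bigl(((w^1,r^1),(w^2,r^2)),(w^1+w^2,r)\bigr)\otimes\mathcal{M}_2(w^1+w^2,r).$$ -/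

import Mathlib

open Module

noncomputable section

namespace GL2Tensor

/-! ### Zariski topologies on the sets of complex points -/

/-- The algebra of polynomial functions on a complex vector space `V`
(generated by the linear functionals). -/
def polyFun (V : Type) [AddCommGroup V] [Module ℂ V] : Subalgebra ℂ (V → ℂ) :=
  Algebra.adjoin ℂ {g | ∃ φ : Module.Dual ℂ V, g = fun x => φ x}

/-- The common zero set of a set of functions. -/
def zeroSet {V : Type} (P : Set (V → ℂ)) : Set V := {x | ∀ p ∈ P, p x = 0}

/-- The Zariski topology on a finite dimensional complex vector space `V`: the closed sets are the
common zero sets of sets of polynomial functions. -/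
@[reducible] def zariski (V : Type) [AddCommGroup V] [Module ℂ V] : TopologicalSpace V :=
  TopologicalSpace.ofClosed {Z | ∃ P : Set (V → ℂ), P ⊆ polyFun V ∧ Z = zeroSet P}
    ⟨{1}, by
      intro p hp
      rw [Set.mem_singleton_iff.1 hp]
      exact (polyFun V).one_mem, by
      ext x
      simp [zeroSet]⟩
    (by
      intro A hA
      refine ⟨{p | p ∈ polyFun V ∧ ∃ Z ∈ A, ∀ x ∈ Z, p x = 0}, fun p hp => hp.1, ?_⟩
      ext x
      constructor
      · rintro hx p ⟨-, Z, hZ, h⟩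
        exact h x (hx Z hZ)
      · intro hx Z hZ
        obtain ⟨P, hP, rfl⟩ := hA hZ
        intro p hp
        exact hx p ⟨hP hp, _, hZ, fun y hy => hy p hp⟩)
    (by
      rintro _ ⟨P, hP, rfl⟩ _ ⟨Q, hQ, rfl⟩
      refine ⟨{f | ∃ p ∈ P, ∃ q ∈ Q, f = p * q}, ?_, ?_⟩
      · rintro _ ⟨p, hp, q, hq, rfl⟩
        exact (polyFun V).mul_mem (hP hp) (hQ hq)
      · ext x
        constructor
        · rintro (hx | hx) _ ⟨p, hp, q, hq, rfl⟩
          · simp [hx p hp]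
          · simp [hx q hq]
        · intro hx
          by_contra hcon
          rw [Set.mem_union, not_or] at hcon
          obtain ⟨h1, h2⟩ := hcon
          simp only [zeroSet, Set.mem_ofPred_eq, not_forall] at h1 h2
          obtain ⟨p, hp, hpx⟩ := h1
          obtain ⟨q, hq, hqx⟩ := h2
          exact mul_ne_zero hpx hqx (hx (p * q) ⟨p, hp, q, hq, rfl⟩))

/-- The space `ℂⁿ`. -/
abbrev Vec (n : ℕ) : Type := Fin n → ℂ

/-- The set `Gr(n)` of all linear subspaces of `ℂⁿ`. -/
abbrev Gr (n : ℕ) : Type := Submodule ℂ (Vec n)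

/-- The Zariski topology on `Gr(n)`, the disjoint union over `m` of the Grassmannians of
`m`-dimensional subspaces: each of these is the quotient of the variety of linearly independent
`m`-tuples of vectors (an open subset of an affine space) by `GL(m)`, so a set is open if and only
if its preimage among the `m`-tuples is open, for every `m`. -/
instance grTopology (n : ℕ) : TopologicalSpace (Gr n) :=
  ⨆ m : ℕ, TopologicalSpace.coinduced
    (fun A : {A : Fin m → Vec n // LinearIndependent ℂ A} => Submodule.span ℂ (Set.range A.1))
    (TopologicalSpace.induced Subtype.val (zariski (Fin m → Vec n)))

/-- Triples `(t, X, F)`: points of `End(ℂⁿ) × Gr(n) × Gr(n)`. -/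
@[ext] structure Triple (n : ℕ) where
  t : End ℂ (Vec n)
  X : Gr n
  F : Gr n

/-- The Zariski topology of the variety `End(ℂⁿ) × Gr(n) × Gr(n)`; as for `Gr(n)`, it is the
quotient topology from pairs of linearly independent tuples (it is not the product topology). -/
instance tripleTopology (n : ℕ) : TopologicalSpace (Triple n) :=
  ⨆ (a : ℕ) (b : ℕ), TopologicalSpace.coinduced
    (fun A : {A : End ℂ (Vec n) × (Fin a → Vec n) × (Fin b → Vec n) //
        LinearIndependent ℂ A.2.1 ∧ LinearIndependent ℂ A.2.2} =>
      (⟨A.1.1, Submodule.span ℂ (Set.range A.1.2.1), Submodule.span ℂ (Set.range A.1.2.2)⟩ :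
        Triple n))
    (TopologicalSpace.induced Subtype.val
      (zariski (End ℂ (Vec n) × (Fin a → Vec n) × (Fin b → Vec n))))

/-- The irreducible components of a subset `S` of a topological space (for the subspace topology),
regarded as subsets of the ambient space. -/
def components {α : Type} [TopologicalSpace α] (S : Set α) : Set (Set α) :=
  (fun C : Set S => Subtype.val '' C) '' irreducibleComponents S

/-! ### The varieties -/

/-- The operators in `ℂʷ` with square zero. -/
def N2 (w : ℕ) : Set (End ℂ (Vec w)) := {t | t * t = 0}

/-- The stratum `O_{(w-r,r)}` of operators of rank `r` and square zero. -/
def O2 (w r : ℕ) : Set (End ℂ (Vec w)) := {t | t ∈ N2 w ∧ finrank ℂ (LinearMap.range t) = r}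

/-- `t` is a chosen point of `O_{(w-r,r)}` (an arbitrary operator if this stratum is empty). -/
def IsBasePoint (w r : ℕ) (t : End ℂ (Vec w)) : Prop := (O2 w r).Nonempty → t ∈ O2 w r

/-- The variety of pairs `(t, F)` with `t² = 0` and `im t ⊆ F ⊆ ker t`. -/
def M2tot (w : ℕ) : Set (End ℂ (Vec w) × Gr w) :=
  {p | p.1 ∈ N2 w ∧ LinearMap.range p.1 ≤ p.2 ∧ p.2 ≤ LinearMap.ker p.1}

/-- The variety `𝔐₂(w,r)`: the fibre of `(t, F) ↦ t` over a point `t` of `O_{(w-r,r)}`, a set of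
subspaces `F`. It is empty if `O_{(w-r,r)}` is. -/
def M2 (w r : ℕ) (t : End ℂ (Vec w)) : Set (Gr w) := {F | t ∈ O2 w r ∧ (t, F) ∈ M2tot w}

/-- The part `𝔐₂(v,w,r)` of `𝔐₂(w,r)` where `dim F = v`. -/
def M2v (v w r : ℕ) (t : End ℂ (Vec w)) : Set (Gr w) := {F | F ∈ M2 w r t ∧ finrank ℂ F = v}

/-- `dim X = w¹`, `tX ⊆ X`, `rank (t|_X) = r¹`, `rank (t|_{ℂⁿ/X}) = r²`. -/
def Compatible {n : ℕ} (w1 r1 r2 : ℕ) (t : End ℂ (Vec n)) (X : Gr n) : Prop :=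
  finrank ℂ X = w1 ∧ ∃ h : X ≤ X.comap t,
    finrank ℂ (LinearMap.range (t.restrict h)) = r1 ∧
    finrank ℂ (LinearMap.range (X.mapQ X t h)) = r2

/-- The Spaltenstein variety `𝔖₂(((w¹,r¹),(w²,r²)),(w¹+w²,r))`, for a point `t` of
`O_{(w¹+w²-r,r)}`. It is empty if `O_{(w¹+w²-r,r)}` is. -/
def S2 (w1 r1 w2 r2 r : ℕ) (t : End ℂ (Vec (w1 + w2))) : Set (Gr (w1 + w2)) :=
  {X | t ∈ O2 (w1 + w2) r ∧ Compatible w1 r1 r2 t X}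

/-- The tensor product variety `𝔗₂(w¹,r¹,w²,r²)`. -/
def T2 (w1 r1 w2 r2 : ℕ) : Set (Triple (w1 + w2)) :=
  {x | (x.t, x.F) ∈ M2tot (w1 + w2) ∧ Compatible w1 r1 r2 x.t x.X}

/-- The locally closed subset `𝔗₂(v¹,w¹,r¹,v²,w²,r²)` of `𝔗₂(w¹,r¹,w²,r²)`:
`dim (F ∩ X) = v¹`, `dim F/(F ∩ X) = v²`. -/
def T2vv (v1 w1 r1 v2 w2 r2 : ℕ) : Set (Triple (w1 + w2)) :=
  {x | x ∈ T2 w1 r1 w2 r2 ∧ finrank ℂ (x.F ⊓ x.X : Gr (w1 + w2)) = v1 ∧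
    finrank ℂ (x.F ⧸ (x.F ⊓ x.X).submoduleOf x.F) = v2}

/-- The preimage of the stratum `O_{(w¹+w²-r,r)}` under the projection `(t, X, F) ↦ t` from
`𝔗₂(v,w¹,r¹,w²,r²)`, the part of `𝔗₂(w¹,r¹,w²,r²)` where `dim F = v`. -/
def T2vr (v w1 r1 w2 r2 r : ℕ) : Set (Triple (w1 + w2)) :=
  {x | x ∈ T2 w1 r1 w2 r2 ∧ finrank ℂ x.F = v ∧ x.t ∈ O2 (w1 + w2) r}

/-- The set `ℳ₂(w,r)` of irreducible components of `𝔐₂(w,r)`. -/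
abbrev M2Comp (w r : ℕ) (t : End ℂ (Vec w)) : Type := components (M2 w r t)

/-- The set of irreducible components of the Spaltenstein variety. -/
abbrev S2Comp (w1 r1 w2 r2 r : ℕ) (t : End ℂ (Vec (w1 + w2))) : Type :=
  components (S2 w1 r1 w2 r2 r t)

/-- The set of irreducible components of the tensor product variety. -/
abbrev T2Comp (w1 r1 w2 r2 : ℕ) : Type := components (T2 w1 r1 w2 r2)

/-- The dimension `v` of the subspaces belonging to a component `C = 𝔐₂(v,w,r)` (they all have the
same dimension). -/
def vdim {n : ℕ} (C : Set (Gr n)) : ℕ := sInf ((fun F : Gr n => finrank ℂ F) '' C)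

/-! ### Crystals for `gl₂` -/

/-- The data of a `gl₂`-crystal. The weight lattice is `ℤ ⊕ ℤ`; `none` is the extra element `0`. -/
structure Crystal (A : Type) where
  wt : A → ℤ × ℤ
  ε : A → ℤ
  φ : A → ℤ
  e : A → Option A
  f : A → Option A

namespace Crystal

variable {A B : Type}

/-- The axioms of a `gl₂`-crystal (the simple root is `(1,-1)`, the simple coroot is `(1,-1)`). -/
structure IsCrystal (K : Crystal A) : Prop where
  e_spec : ∀ a b, K.e a = some b →
    K.wt b = K.wt a + (1, -1) ∧ K.φ b = K.φ a + 1 ∧ K.ε b = K.ε a - 1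
  f_spec : ∀ a b, K.f a = some b →
    K.wt b = K.wt a - (1, -1) ∧ K.φ b = K.φ a - 1 ∧ K.ε b = K.ε a + 1
  pairing : ∀ a, (K.wt a).1 - (K.wt a).2 = K.φ a - K.ε a
  f_iff_e : ∀ a b, K.f a = some b ↔ K.e b = some a

/-- The `n`-th iterate of an operator `A → A ∪ {0}`, with `0` sent to `0`. -/
def iter (g : A → Option A) (n : ℕ) (a : A) : Option A := (fun x => x.bind g)^[n] (some a)

/-- A normal crystal: `ε(a) = max {n | eⁿ a ≠ 0}` and `φ(a) = max {n | fⁿ a ≠ 0}`. -/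
structure IsNormal (K : Crystal A) : Prop extends IsCrystal K where
  ε_eq : ∀ a, IsGreatest {m : ℤ | ∃ n : ℕ, m = n ∧ iter K.e n a ≠ none} (K.ε a)
  φ_eq : ∀ a, IsGreatest {m : ℤ | ∃ n : ℕ, m = n ∧ iter K.f n a ≠ none} (K.φ a)

/-- The trivial crystal structure on a set. -/
def triv (A : Type) : Crystal A where
  wt _ := 0
  ε _ := 0
  φ _ := 0
  e _ := none
  f _ := none

/-- The tensor product of crystals. -/
def tensor (K : Crystal A) (L : Crystal B) : Crystal (A × B) where
  wt p := K.wt p.1 + L.wt p.2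
  ε p := max (K.ε p.1) (K.ε p.1 + L.ε p.2 - K.φ p.1)
  φ p := max (L.φ p.2) (K.φ p.1 + L.φ p.2 - L.ε p.2)
  e p := if L.ε p.2 ≤ K.φ p.1 then (K.e p.1).map (fun a => (a, p.2))
    else (L.e p.2).map (fun b => (p.1, b))
  f p := if L.ε p.2 < K.φ p.1 then (K.f p.1).map (fun a => (a, p.2))
    else (L.f p.2).map (fun b => (p.1, b))

/-- The direct sum (disjoint union) of a family of crystals. -/
def directSum {ι : Type} {A : ι → Type} (K : ∀ i, Crystal (A i)) : Crystal (Σ i, A i) where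
  wt p := (K p.1).wt p.2
  ε p := (K p.1).ε p.2
  φ p := (K p.1).φ p.2
  e p := ((K p.1).e p.2).map (Sigma.mk p.1)
  f p := ((K p.1).f p.2).map (Sigma.mk p.1)

/-- A bijection is a crystal isomorphism if it commutes with `wt`, `ε`, `φ`, `e` and `f`. -/
structure IsIso (K : Crystal A) (L : Crystal B) (τ : A ≃ B) : Prop where
  wt : ∀ a, L.wt (τ a) = K.wt a
  ε : ∀ a, L.ε (τ a) = K.ε a
  φ : ∀ a, L.φ (τ a) = K.φ a
  e : ∀ a, L.e (τ a) = (K.e a).map τ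
  f : ∀ a, L.f (τ a) = (K.f a).map τ

end Crystal

open Classical in
/-- The crystal structure on `ℳ₂(w,r)`. On `𝔐₂(v,w,r)` one has `wt = (v, w-v)`, `ε = w-r-v`,
`φ = v-r`; the operator `e` gives `𝔐₂(v+1,w,r)` if `v < w-r` and `0` otherwise, and `f` gives
`𝔐₂(v-1,w,r)` if `v > r` and `0` otherwise. (The pieces so obtained are components, so the second
halves of the two conditions follow from the first halves.) -/
def M2Crystal (w r : ℕ) (t : End ℂ (Vec w)) : Crystal (M2Comp w r t) where
  wt C := ((vdim C.1 : ℤ), (w : ℤ) - vdim C.1)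
  ε C := (w : ℤ) - r - vdim C.1
  φ C := (vdim C.1 : ℤ) - r
  e C := if h : vdim C.1 + r < w ∧ M2v (vdim C.1 + 1) w r t ∈ components (M2 w r t)
    then some ⟨_, h.2⟩ else none
  f C := if h : r < vdim C.1 ∧ M2v (vdim C.1 - 1) w r t ∈ components (M2 w r t)
    then some ⟨_, h.2⟩ else none

/-- The crystal `⨁_r 𝒮₂(((w¹,r¹),(w²,r²)),(w¹+w²,r)) ⊗ ℳ₂(w¹+w²,r)`, the first factors being
trivial crystals. Here `t r` is the chosen point of the stratum `O_{(w¹+w²-r,r)}`. -/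
def sumCrystal (w1 r1 w2 r2 : ℕ) (t : ℕ → End ℂ (Vec (w1 + w2))) :
    Crystal (Σ r : ℕ, S2Comp w1 r1 w2 r2 r (t r) × M2Comp (w1 + w2) r (t r)) :=
  Crystal.directSum fun r =>
    (Crystal.triv (S2Comp w1 r1 w2 r2 r (t r))).tensor (M2Crystal (w1 + w2) r (t r))

end GL2Tensor

end

open GL2Tensor

/-! The variety of triples `(t, X, F)` is cut into locally closed pieces in two ways: by `(v¹, v²)`,
the dimensions of `F ∩ X` and `F/(F ∩ X)`, and by `(v, r)`, the dimension of `F` and the rank of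
`t`. All pieces are irreducible, being images of Zariski open subsets of vector spaces under
polynomial maps. For the first kind (`isPreirreducible_T2vv_add`), `X` and `F` are moved to a
standard position, where `t` becomes a block operator with two blocks of prescribed rank and one
free block. For the second (`isPreirreducible_T2vr`), the pairs `(t, X)` form one conjugacy class
(`exists_equiv_conj`), and for fixed `t` the possible `F` form one orbit of the centralizer of `t`.

On a piece of the first kind the rank of `t` is at most `genericRank`, and this bound is attained;
on the corresponding piece of the second kind `dim (F ∩ X)` is at least `v¹`, again attained. By
semicontinuity the two pieces share a subset that is relatively open and nonempty in each, so their
closures coincide (`closure_T2vv_eq`). For fixed `v¹ + v²` the generic rank increases strictly with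
`v¹`, while `dim (F ∩ X)` can only jump up under specialization and the rank only down; hence no
piece lies in the closure of another (`eq_of_T2vv_subset_closure`), and the closures are exactly the
components.

This computes `β⁻¹ ∘ α`. The crystals involved are disjoint unions of strings, in which an element
is determined by a label and a position (`IsStrings`). In the tensor product the label is the
generic rank and the position is `v¹ + v²` (`IsStrings.tensor`), which are the coordinates that `β⁻¹
∘ α` preserves. -/

noncomputable section

open scoped Topology

namespace GL2Tensor

/-! ### Polynomial maps and the Zariski topology on vector spaces. -/

section Zariski

variable {W V V₁ V₂ : Type} [AddCommGroup W] [Module ℂ W] [AddCommGroup V] [Module ℂ V]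
  [AddCommGroup V₁] [Module ℂ V₁] [AddCommGroup V₂] [Module ℂ V₂]

lemma dual_mem_polyFun (φ : Dual ℂ W) : (fun x => φ x) ∈ polyFun W :=
  Algebra.subset_adjoin ⟨φ, rfl⟩

/-- A map between vector spaces is polynomial if its composites with linear functionals are. -/
def IsPolyMap (f : W → V) : Prop := ∀ φ : Dual ℂ V, (fun x => φ (f x)) ∈ polyFun W

lemma IsPolyMap.comp_polyFun {f : W → V} (hf : IsPolyMap f) {p : V → ℂ} (hp : p ∈ polyFun V) :
    (fun x => p (f x)) ∈ polyFun W := by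
  induction hp using Algebra.adjoin_induction with
  | mem p hp => obtain ⟨φ, rfl⟩ := hp; exact hf φ
  | algebraMap r => exact (polyFun W).algebraMap_mem r
  | add p q _ _ hp hq => exact (polyFun W).add_mem hp hq
  | mul p q _ _ hp hq => exact (polyFun W).mul_mem hp hq

lemma IsPolyMap.comp {f : V → V₁} {g : W → V} (hf : IsPolyMap f) (hg : IsPolyMap g) :
    IsPolyMap (fun x => f (g x)) := fun φ => hg.comp_polyFun (hf φ)

lemma isPolyMap_linear (f : W →ₗ[ℂ] V) : IsPolyMap f := fun φ => dual_mem_polyFun (φ.comp f)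

lemma isPolyMap_const (v : V) : IsPolyMap (fun _ : W => v) :=
  fun φ => (polyFun W).algebraMap_mem (φ v)

lemma isPolyMap_iff_mem {f : W → ℂ} : IsPolyMap f ↔ f ∈ polyFun W := by
  refine ⟨fun h => h LinearMap.id, fun h φ => ?_⟩
  have : (fun x => φ (f x)) = φ 1 • f := by
    ext x
    rw [Pi.smul_apply, smul_eq_mul, mul_comm, ← smul_eq_mul, ← map_smul, smul_eq_mul, mul_one]
  rw [this]
  exact (polyFun W).smul_mem h _

lemma IsPolyMap.add {f g : W → V} (hf : IsPolyMap f) (hg : IsPolyMap g) :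
    IsPolyMap (fun x => f x + g x) := fun φ => by
  simp only [map_add]
  exact (polyFun W).add_mem (hf φ) (hg φ)

lemma IsPolyMap.prodMk {f : W → V} {g : W → V₁} (hf : IsPolyMap f) (hg : IsPolyMap g) :
    IsPolyMap (fun x => (f x, g x)) := fun φ => by
  have : (fun x => φ (f x, g x)) = fun x => φ.comp (LinearMap.inl ℂ V V₁) (f x) +
      φ.comp (LinearMap.inr ℂ V V₁) (g x) := by
    ext x
    simp [← map_add]
  rw [this]
  exact (polyFun W).add_mem (hf _) (hg _)

lemma IsPolyMap.of_basis {ι : Type} [Fintype ι] (b : Basis ι ℂ V) {f : W → V}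
    (h : ∀ i, (fun x => b.repr (f x) i) ∈ polyFun W) : IsPolyMap f := fun φ => by
  have : (fun x => φ (f x)) = ∑ i, φ (b i) • (fun x => b.repr (f x) i) := by
    ext x
    conv_lhs => rw [← b.sum_repr (f x), map_sum]
    simp [-Basis.sum_repr, mul_comm]
  rw [this]
  exact (polyFun W).sum_mem fun i _ => (polyFun W).smul_mem (h i) _

lemma IsPolyMap.pi {ι : Type} [Fintype ι] {f : W → ι → V}
    (h : ∀ i, IsPolyMap (fun x => f x i)) : IsPolyMap f := fun φ => by
  classical
  have : (fun x => φ (f x)) = ∑ i, fun x => φ.comp (LinearMap.single ℂ (fun _ => V) i) (f x i) := by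
    ext x
    conv_lhs => rw [← Finset.univ_sum_single (f x), map_sum]
    simp
  rw [this]
  exact (polyFun W).sum_mem fun i _ => h i _

lemma IsPolyMap.bilin [FiniteDimensional ℂ V] {f : W → V} {g : W → V₁} (hf : IsPolyMap f)
    (hg : IsPolyMap g) (B : V →ₗ[ℂ] V₁ →ₗ[ℂ] V₂) : IsPolyMap (fun x => B (f x) (g x)) := fun φ => by
  let b := finBasis ℂ V
  have : (fun x => φ (B (f x) (g x))) =
      ∑ i, (fun x => b.coord i (f x)) * (fun x => φ.comp (B (b i)) (g x)) := by
    ext x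
    conv_lhs => rw [← b.sum_repr (f x), map_sum, LinearMap.sum_apply, map_sum]
    simp
  rw [this]
  exact (polyFun W).sum_mem fun i _ => (polyFun W).mul_mem (hf _) (hg _)

lemma IsPolyMap.linComp {U : Type} [AddCommGroup U] [Module ℂ U] [FiniteDimensional ℂ V]
    [FiniteDimensional ℂ V₁] {f : W → V →ₗ[ℂ] V₁} {g : W → U →ₗ[ℂ] V}
    (hf : IsPolyMap f) (hg : IsPolyMap g) : IsPolyMap (fun x => f x ∘ₗ g x) :=
  hf.bilin hg (LinearMap.llcomp ℂ U V V₁)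

lemma IsPolyMap.apply [FiniteDimensional ℂ V] [FiniteDimensional ℂ V₁] {f : W → V →ₗ[ℂ] V₁}
    (hf : IsPolyMap f) (v : V) : IsPolyMap (fun x => f x v) :=
  (isPolyMap_linear (LinearMap.applyₗ v)).comp hf

lemma IsPolyMap.smul {c : W → ℂ} {f : W → V}
    (hc : IsPolyMap c) (hf : IsPolyMap f) : IsPolyMap (fun x => c x • f x) :=
  hc.bilin hf (LinearMap.lsmul ℂ V)

lemma det_mem_polyFun {n : ℕ} {M : W → Matrix (Fin n) (Fin n) ℂ}
    (h : ∀ i j, (fun x => M x i j) ∈ polyFun W) : (fun x => (M x).det) ∈ polyFun W := by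
  have : (fun x => (M x).det) =
      ∑ σ : Equiv.Perm (Fin n), ((Equiv.Perm.sign σ : ℤ) : ℂ) • ∏ i, fun x => M x (σ i) i := by
    ext x
    simp [Matrix.det_apply']
  rw [this]
  exact (polyFun W).sum_mem fun σ _ => (polyFun W).smul_mem
    ((polyFun W).prod_mem fun i _ => h _ _) _

/-- The adjugate of an operator on `ℂⁿ`. -/
def adj {n : ℕ} (g : End ℂ (Vec n)) : End ℂ (Vec n) :=
  Matrix.toLin' (LinearMap.toMatrix' g).adjugate

/-- The inverse is not polynomial in `g`, but the adjugate is, and it agrees with the inverse up to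
the factor `det g`. Conjugation is therefore done with `adj g`, up to a nonzero scalar. -/
lemma adj_comp {n : ℕ} (g : End ℂ (Vec n)) : adj g ∘ₗ g = LinearMap.det g • LinearMap.id := by
  rw [adj]
  conv_lhs => rw [← Matrix.toLin'_toMatrix' g]
  rw [LinearMap.toMatrix'_toLin', ← Matrix.toLin'_mul, Matrix.adjugate_mul, map_smul,
    Matrix.toLin'_one, LinearMap.det_toMatrix']

lemma toMatrix'_entry_mem_polyFun {n : ℕ} {f : W → End ℂ (Vec n)} (hf : IsPolyMap f) (i j : Fin n) :
    (fun x => LinearMap.toMatrix' (f x) i j) ∈ polyFun W := by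
  simp only [LinearMap.toMatrix'_apply]
  exact hf.apply (Pi.single j 1) (LinearMap.proj i)

lemma IsPolyMap.det {n : ℕ} {f : W → End ℂ (Vec n)} (hf : IsPolyMap f) :
    (fun x => LinearMap.det (f x)) ∈ polyFun W := by
  simp only [← LinearMap.det_toMatrix']
  exact det_mem_polyFun fun i j => toMatrix'_entry_mem_polyFun hf i j

lemma IsPolyMap.adj {n : ℕ} {f : W → End ℂ (Vec n)} (hf : IsPolyMap f) :
    IsPolyMap (fun x => adj (f x)) := by
  refine (isPolyMap_linear (Matrix.toLin' : Matrix (Fin n) (Fin n) ℂ ≃ₗ[ℂ] _).toLinearMap).comp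
    (f := _) (g := fun x => (LinearMap.toMatrix' (f x)).adjugate) ?_
  refine IsPolyMap.of_basis (Matrix.stdBasis ℂ (Fin n) (Fin n)) fun ⟨i, j⟩ => ?_
  have : ∀ M : Matrix (Fin n) (Fin n) ℂ, (Matrix.stdBasis ℂ (Fin n) (Fin n)).repr M (i, j) = M i j :=
    fun M => rfl
  simp only [this, Matrix.adjugate_apply]
  refine det_mem_polyFun fun a b => ?_
  simp only [Matrix.updateRow_apply]
  split_ifs
  · exact (polyFun W).algebraMap_mem _
  · exact toMatrix'_entry_mem_polyFun hf _ _

lemma isOpen_zariski_iff {U : Set W} : IsOpen[zariski W] U ↔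
    ∃ P : Set (W → ℂ), P ⊆ polyFun W ∧ Uᶜ = zeroSet P := Iff.rfl

lemma isOpen_ne_zero {p : W → ℂ} (hp : p ∈ polyFun W) : IsOpen[zariski W] {x | p x ≠ 0} := by
  refine isOpen_zariski_iff.2 ⟨{p}, by simpa using hp, ?_⟩
  ext x
  simp [zeroSet]

lemma IsPolyMap.continuous {f : W → V} (hf : IsPolyMap f) : @Continuous W V (zariski W) (zariski V) f := by
  refine @Continuous.mk _ _ (zariski W) (zariski V) _ fun U hU => ?_
  obtain ⟨P, hP, h⟩ := isOpen_zariski_iff.1 hU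
  refine isOpen_zariski_iff.2 ⟨(fun p x => p (f x)) '' P, ?_, ?_⟩
  · rintro _ ⟨p, hp, rfl⟩
    exact hf.comp_polyFun (hP hp)
  · rw [← Set.preimage_compl, h]
    ext x
    simp [zeroSet]

/-- On the line through `x` and `y` both functions become polynomials in one variable, nonzero at
`0` and at `1` respectively, so their product is a nonzero polynomial. This is what makes open
subsets irreducible. -/
lemma polyFun_mul_ne_zero {p q : W → ℂ} (hp : p ∈ polyFun W) (hq : q ∈ polyFun W) {x y : W}
    (hx : p x ≠ 0) (hy : q y ≠ 0) : ∃ z, p z ≠ 0 ∧ q z ≠ 0 := by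
  have key : ∀ p ∈ polyFun W, ∃ P : Polynomial ℂ, ∀ s : ℂ, p (x + s • (y - x)) = P.eval s := by
    intro p hp
    induction hp using Algebra.adjoin_induction with
    | mem p hp =>
      obtain ⟨φ, rfl⟩ := hp
      exact ⟨.C (φ x) + .X * .C (φ (y - x)), fun s => by simp⟩
    | algebraMap r => exact ⟨.C r, fun s => by simp⟩
    | add p q _ _ hp hq =>
      obtain ⟨P, hP⟩ := hp
      obtain ⟨Q, hQ⟩ := hq
      exact ⟨P + Q, fun s => by simp [hP, hQ]⟩
    | mul p q _ _ hp hq =>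
      obtain ⟨P, hP⟩ := hp
      obtain ⟨Q, hQ⟩ := hq
      exact ⟨P * Q, fun s => by simp [hP, hQ]⟩
  obtain ⟨P, hP⟩ := key p hp
  obtain ⟨Q, hQ⟩ := key q hq
  have hP0 : P ≠ 0 := by rintro rfl; exact hx (by simpa using hP 0)
  have hQ0 : Q ≠ 0 := by rintro rfl; exact hy (by simpa using hQ 1)
  obtain ⟨s, hs⟩ : ∃ s, (P * Q).eval s ≠ 0 := by
    by_contra! h
    exact mul_ne_zero hP0 hQ0 (Polynomial.funext (by simpa using h))
  rw [Polynomial.eval_mul] at hs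
  exact ⟨_, hP s ▸ left_ne_zero_of_mul hs, hQ s ▸ right_ne_zero_of_mul hs⟩

lemma exists_ne_zero_of_isOpen {U : Set W} (hU : IsOpen[zariski W] U) {x : W} (hx : x ∈ U) :
    ∃ p ∈ polyFun W, p x ≠ 0 ∧ ∀ y, p y ≠ 0 → y ∈ U := by
  obtain ⟨P, hP, h⟩ := isOpen_zariski_iff.1 hU
  have : x ∉ zeroSet P := fun hx' => (h ▸ hx' : x ∈ Uᶜ) hx
  simp only [zeroSet, Set.mem_ofPred_eq, not_forall] at this
  obtain ⟨p, hp, hpx⟩ := this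
  refine ⟨p, hP hp, hpx, fun y hy => ?_⟩
  by_contra hyU
  exact hy ((h ▸ hyU : y ∈ zeroSet P) p hp)

lemma isPreirreducible_of_isOpen {U : Set W} (hU : IsOpen[zariski W] U) :
    @IsPreirreducible W (zariski W) U := by
  rintro u v hu hv ⟨x, hxU, hxu⟩ ⟨y, hyU, hyv⟩
  obtain ⟨p, hp, hpx, hp'⟩ := exists_ne_zero_of_isOpen ((zariski W).isOpen_inter _ _ hU hu) ⟨hxU, hxu⟩
  obtain ⟨q, hq, hqy, hq'⟩ := exists_ne_zero_of_isOpen hv hyv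
  obtain ⟨z, hz, hz'⟩ := polyFun_mul_ne_zero hp hq hpx hqy
  exact ⟨z, (hp' z hz).1, (hp' z hz).2, hq' z hz'⟩

/-- A coordinate-free form of the criterion by nonvanishing minors; it exhibits a lower bound on the
rank as an open condition. -/
lemma le_finrank_range_iff [FiniteDimensional ℂ V] {s : ℕ} (f : V₁ →ₗ[ℂ] V) :
    s ≤ finrank ℂ (LinearMap.range f) ↔
      ∃ (a : Vec s →ₗ[ℂ] V₁) (b : V →ₗ[ℂ] Vec s), LinearMap.det (b ∘ₗ f ∘ₗ a) ≠ 0 := by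
  constructor
  · intro h
    obtain ⟨u, hu⟩ := exists_linearIndependent_of_le_finrank h
    have hu' : LinearIndependent ℂ (fun i => (u i : V)) :=
      hu.map' (LinearMap.range f).subtype (Submodule.ker_subtype _)
    choose v hv using fun i => (u i).2
    let g : Vec s →ₗ[ℂ] V := Fintype.linearCombination ℂ (fun i => (u i : V))
    have hg : LinearMap.ker g = ⊥ := by
      rw [LinearMap.ker_eq_bot]
      exact hu'.fintypeLinearCombination_injective
    obtain ⟨b, hb⟩ := g.exists_leftInverse_of_injective hg
    refine ⟨Fintype.linearCombination ℂ v, b, ?_⟩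
    have : f ∘ₗ Fintype.linearCombination ℂ v = g := by
      refine LinearMap.ext fun x => ?_
      simp [g, Fintype.linearCombination_apply, hv]
    rw [this, hb]
    simp
  · rintro ⟨a, b, h⟩
    have h2 : LinearMap.range (b ∘ₗ f ∘ₗ a) = ⊤ := by
      rw [LinearMap.range_eq_top]
      exact (LinearMap.equivOfDetNeZero _ h).surjective
    have h3 : finrank ℂ (LinearMap.range (b ∘ₗ f ∘ₗ a)) = s := by
      rw [h2, finrank_top, finrank_fin_fun]
    rw [← h3, LinearMap.range_comp]
    refine (Submodule.finrank_map_le _ _).trans (Submodule.finrank_mono ?_)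
    exact LinearMap.range_comp_le_range _ _

lemma isOpen_le_finrank_range [FiniteDimensional ℂ V] [FiniteDimensional ℂ V₁] (s : ℕ)
    {L : W → V₁ →ₗ[ℂ] V} (hL : IsPolyMap L) :
    IsOpen[zariski W] {x | s ≤ finrank ℂ (LinearMap.range (L x))} := by
  have : {x | s ≤ finrank ℂ (LinearMap.range (L x))} =
      ⋃ (a : Vec s →ₗ[ℂ] V₁) (b : V →ₗ[ℂ] Vec s), {x | LinearMap.det (b ∘ₗ L x ∘ₗ a) ≠ 0} := by
    ext x
    simp [le_finrank_range_iff]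
  rw [this]
  refine @isOpen_iUnion _ _ (zariski W) _ fun a => @isOpen_iUnion _ _ (zariski W) _ fun b => ?_
  exact isOpen_ne_zero ((isPolyMap_const b).linComp (hL.linComp (isPolyMap_const a))).det

end Zariski

/-! ### The topologies on subspaces and triples, seen through frames. -/

section Charts

variable {W : Type} [AddCommGroup W] [Module ℂ W] {n : ℕ}

lemma isOpen_triple_iff {U : Set (Triple n)} : IsOpen U ↔ ∀ a b : ℕ,
    ∃ U' : Set (End ℂ (Vec n) × (Fin a → Vec n) × (Fin b → Vec n)), IsOpen[zariski _] U' ∧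
      ∀ A, LinearIndependent ℂ A.2.1 → LinearIndependent ℂ A.2.2 → (A ∈ U' ↔
        (⟨A.1, Submodule.span ℂ (Set.range A.2.1), Submodule.span ℂ (Set.range A.2.2)⟩ :
          Triple n) ∈ U) := by
  simp only [isOpen_iSup_iff, isOpen_coinduced]
  refine forall₂_congr fun a b => ?_
  refine (@isOpen_induced_iff _ _ (zariski _) _ _).trans
    (exists_congr fun U' => and_congr_right fun _ => ?_)
  simp [Set.ext_iff, and_imp]

lemma isOpen_gr_iff {U : Set (Gr n)} : IsOpen U ↔ ∀ m : ℕ,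
    ∃ U' : Set (Fin m → Vec n), IsOpen[zariski _] U' ∧
      ∀ A, LinearIndependent ℂ A → (A ∈ U' ↔ Submodule.span ℂ (Set.range A) ∈ U) := by
  simp only [isOpen_iSup_iff, isOpen_coinduced]
  refine forall_congr' fun m => ?_
  refine (@isOpen_induced_iff _ _ (zariski _) _ _).trans
    (exists_congr fun U' => and_congr_right fun _ => ?_)
  simp [Set.ext_iff]

/-- The topology is a quotient of the Zariski topology on frames, so a polynomial family of frames
pulls open sets back to open sets, and irreducibility of the parameter set passes to the image. -/
lemma isPreirreducible_gr_image {m : ℕ} {U : Set W} (hU : IsOpen[zariski W] U)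
    {f : W → Fin m → Vec n} (hf : IsPolyMap f) (hU' : ∀ x ∈ U, LinearIndependent ℂ (f x)) :
    IsPreirreducible ((fun x => Submodule.span ℂ (Set.range (f x))) '' U) := by
  rintro u v hu hv ⟨_, ⟨x, hx, rfl⟩, hxu⟩ ⟨_, ⟨y, hy, rfl⟩, hyv⟩
  obtain ⟨u', hu', hu1⟩ := isOpen_gr_iff.1 hu m
  obtain ⟨v', hv', hv1⟩ := isOpen_gr_iff.1 hv m
  obtain ⟨z, hz, hzu, hzv⟩ := isPreirreducible_of_isOpen hU _ _
    (@IsOpen.preimage _ _ (zariski _) (zariski _) _ hf.continuous _ hu')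
    (@IsOpen.preimage _ _ (zariski _) (zariski _) _ hf.continuous _ hv')
    ⟨x, hx, (hu1 _ (hU' x hx)).2 hxu⟩ ⟨y, hy, (hv1 _ (hU' y hy)).2 hyv⟩
  exact ⟨_, ⟨z, hz, rfl⟩, (hu1 _ (hU' z hz)).1 hzu, (hv1 _ (hU' z hz)).1 hzv⟩

lemma isPreirreducible_triple_image {a b : ℕ} {U : Set W} (hU : IsOpen[zariski W] U)
    {f : W → End ℂ (Vec n)} {g : W → Fin a → Vec n} {h : W → Fin b → Vec n}
    (hf : IsPolyMap f) (hg : IsPolyMap g) (hh : IsPolyMap h)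
    (hgU : ∀ x ∈ U, LinearIndependent ℂ (g x)) (hhU : ∀ x ∈ U, LinearIndependent ℂ (h x)) :
    IsPreirreducible ((fun x => (⟨f x, Submodule.span ℂ (Set.range (g x)),
      Submodule.span ℂ (Set.range (h x))⟩ : Triple n)) '' U) := by
  rintro u v hu hv ⟨_, ⟨x, hx, rfl⟩, hxu⟩ ⟨_, ⟨y, hy, rfl⟩, hyv⟩
  obtain ⟨u', hu', hu1⟩ := isOpen_triple_iff.1 hu a b
  obtain ⟨v', hv', hv1⟩ := isOpen_triple_iff.1 hv a b
  have hF := (hf.prodMk (hg.prodMk hh)).continuous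
  obtain ⟨z, hz, hzu, hzv⟩ := isPreirreducible_of_isOpen hU _ _
    (@IsOpen.preimage _ _ (zariski _) (zariski _) _ hF _ hu')
    (@IsOpen.preimage _ _ (zariski _) (zariski _) _ hF _ hv')
    ⟨x, hx, (hu1 (f x, g x, h x) (hgU x hx) (hhU x hx)).2 hxu⟩
    ⟨y, hy, (hv1 (f y, g y, h y) (hgU y hy) (hhU y hy)).2 hyv⟩
  exact ⟨_, ⟨z, hz, rfl⟩, (hu1 (f z, g z, h z) (hgU z hz) (hhU z hz)).1 hzu,
    (hv1 (f z, g z, h z) (hgU z hz) (hhU z hz)).1 hzv⟩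

lemma finrank_span_range {m : ℕ} {A : Fin m → Vec n} (hA : LinearIndependent ℂ A) :
    finrank ℂ (Submodule.span ℂ (Set.range A)) = m := by
  rw [finrank_span_eq_card hA, Fintype.card_fin]

/-- The dimension is constant on each chart, hence locally constant; arbitrary `p` gives both open
and closed conditions. -/
lemma isOpen_gr_finrank (p : ℕ → Prop) : IsOpen {F : Gr n | p (finrank ℂ F)} := by
  refine isOpen_gr_iff.2 fun m => ⟨{_A | p m}, ?_, fun A hA => ?_⟩
  · exact @isOpen_const _ (zariski _) _
  · simp [finrank_span_range hA]

lemma isOpen_triple_finrank (p : ℕ → Prop) : IsOpen {x : Triple n | p (finrank ℂ x.F)} := by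
  refine isOpen_triple_iff.2 fun a b => ⟨{_A | p b}, ?_, fun A _ hA => ?_⟩
  · exact @isOpen_const _ (zariski _) _
  · simp [finrank_span_range hA]

lemma isOpen_triple_le_rank (r : ℕ) :
    IsOpen {x : Triple n | r ≤ finrank ℂ (LinearMap.range x.t)} := by
  refine isOpen_triple_iff.2 fun a b => ⟨_, isOpen_le_finrank_range r
    (L := fun A : End ℂ (Vec n) × (Fin a → Vec n) × (Fin b → Vec n) => A.1) ?_,
    fun A _ _ => Iff.rfl⟩
  exact fun φ => dual_mem_polyFun
    (φ.comp (LinearMap.fst ℂ (End ℂ (Vec n)) ((Fin a → Vec n) × (Fin b → Vec n))))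

lemma isOpen_triple_finrank_inf_le (k : ℕ) :
    IsOpen {x : Triple n | finrank ℂ (x.F ⊓ x.X : Gr n) ≤ k} := by
  refine isOpen_triple_iff.2 fun a b => ?_
  -- The two frames together define a map with image `X + F`, so an upper bound on `dim (F ∩ X)` is
  -- a lower bound on the rank of this map.
  let L : (End ℂ (Vec n) × (Fin a → Vec n) × (Fin b → Vec n)) →
      ((Vec a × Vec b) →ₗ[ℂ] Vec n) := fun A =>
    (Fintype.linearCombination ℂ A.2.1).coprod (Fintype.linearCombination ℂ A.2.2)
  have hL : IsPolyMap L := by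
    refine isPolyMap_linear (⟨⟨L, fun A B => ?_⟩, fun c A => ?_⟩ :
      (End ℂ (Vec n) × (Fin a → Vec n) × (Fin b → Vec n)) →ₗ[ℂ] _)
    · refine LinearMap.ext fun x => ?_
      simp only [L, LinearMap.coprod_apply, Fintype.linearCombination_apply, LinearMap.add_apply,
        Prod.snd_add, Prod.fst_add, Pi.add_apply, smul_add, Finset.sum_add_distrib]
      abel
    · refine LinearMap.ext fun x => ?_
      simp [L, Fintype.linearCombination_apply, Finset.smul_sum, smul_comm c]
  refine ⟨_, isOpen_le_finrank_range (a + b - k) hL, fun A hA hB => ?_⟩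
  have h1 := finrank_span_range hA
  have h2 := finrank_span_range hB
  have h3 := Submodule.finrank_sup_add_finrank_inf_eq (Submodule.span ℂ (Set.range A.2.1))
    (Submodule.span ℂ (Set.range A.2.2))
  have h4 : LinearMap.range (L A) =
      Submodule.span ℂ (Set.range A.2.1) ⊔ Submodule.span ℂ (Set.range A.2.2) := by
    simp [L, LinearMap.range_coprod, Fintype.range_linearCombination]
  change a + b - k ≤ finrank ℂ (LinearMap.range (L A)) ↔ finrank ℂ
    (Submodule.span ℂ (Set.range A.2.2) ⊓ Submodule.span ℂ (Set.range A.2.1) : Gr n) ≤ k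
  rw [h4, inf_comm]
  omega

end Charts

/-! ### Classification of configurations of subspaces and of stable pairs. -/

section LinearAlgebra

variable {V V' : Type} [AddCommGroup V] [Module ℂ V] [FiniteDimensional ℂ V]
  [AddCommGroup V'] [Module ℂ V'] [FiniteDimensional ℂ V']

lemma exists_equiv_id_on_map_eq {A C C' : Submodule ℂ V} (h : Disjoint A C) (h' : Disjoint A C')
    (hC : finrank ℂ C = finrank ℂ C') :
    ∃ g : V ≃ₗ[ℂ] V, (∀ a ∈ A, g a = a) ∧ C.map (g : V →ₗ[ℂ] V) = C' := by
  let e : C ≃ₗ[ℂ] C' := LinearEquiv.ofFinrankEq _ _ hC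
  have inj : ∀ {C : Submodule ℂ V}, Disjoint A C →
      Function.Injective (A.subtype.coprod C.subtype) := fun {C} h => by
    rw [← LinearMap.ker_eq_bot, LinearMap.ker_coprod_of_disjoint_range _ _ (by simpa using h)]
    simp
  let i := LinearEquiv.ofInjective _ (inj h)
  let i' := LinearEquiv.ofInjective _ (inj h')
  obtain ⟨g, hg⟩ := Submodule.exists_linearEquiv_restrict_eq
    (i.symm ≪≫ₗ (LinearEquiv.refl ℂ A).prodCongr e ≪≫ₗ i')
  have key : ∀ (a : A) (c : C), g (a + c) = a + e c := fun a c => by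
    have := hg (i (a, c))
    simpa [i, i'] using this.symm
  refine ⟨g, fun a ha => by simpa using key ⟨a, ha⟩ 0, ?_⟩
  have hc : ∀ c : C, g c = e c := fun c => by simpa using key 0 c
  ext x
  constructor
  · rintro ⟨c, hc', rfl⟩
    exact (hc ⟨c, hc'⟩).symm ▸ (e ⟨c, hc'⟩).2
  · intro hx
    refine ⟨e.symm ⟨x, hx⟩, (e.symm ⟨x, hx⟩).2, ?_⟩
    simpa using hc (e.symm ⟨x, hx⟩)

lemma finrank_sup_of_disjoint {A C : Submodule ℂ V} (h : Disjoint A C) :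
    finrank ℂ (A ⊔ C : Submodule ℂ V) = finrank ℂ A + finrank ℂ C := by
  rw [← Submodule.finrank_sup_add_finrank_inf_eq, h.eq_bot, finrank_bot, add_zero]

omit [FiniteDimensional ℂ V] [FiniteDimensional ℂ V'] in
lemma map_equiv_congr {Φ Φ' : V ≃ₗ[ℂ] V'} {A B : Submodule ℂ V} (h : ∀ a ∈ A, Φ' a = Φ a)
    (hB : B ≤ A) : B.map (Φ' : V →ₗ[ℂ] V') = B.map (Φ : V →ₗ[ℂ] V') := by
  ext x
  constructor
  · rintro ⟨b, hb, rfl⟩; exact ⟨b, hb, (h b (hB hb)).symm⟩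
  · rintro ⟨b, hb, rfl⟩; exact ⟨b, hb, h b (hB hb)⟩

/-- The hypothesis `h` says that `Φ` already matches `A ∩ B` with the part of `B'` inside `Φ(A)`. A
complement of `A ∩ B` in `B` is disjoint from `A`, so `Φ` can be corrected there without changing it
on `A`. -/
lemma exists_equiv_extend (Φ : V ≃ₗ[ℂ] V') {A B : Submodule ℂ V} {B' : Submodule ℂ V'}
    (h : A.map (Φ : V →ₗ[ℂ] V') ⊓ B' = (A ⊓ B).map (Φ : V →ₗ[ℂ] V'))
    (hB : finrank ℂ B = finrank ℂ B') :
    ∃ Φ' : V ≃ₗ[ℂ] V', (∀ a ∈ A, Φ' a = Φ a) ∧ B.map (Φ' : V →ₗ[ℂ] V') = B' := by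
  obtain ⟨C, hC, hCB⟩ := IsModularLattice.exists_disjoint_and_sup_eq (inf_le_right : A ⊓ B ≤ B)
  have hIB : (A ⊓ B).map (Φ : V →ₗ[ℂ] V') ≤ B' := h ▸ inf_le_right
  obtain ⟨D, hD, hDB⟩ := IsModularLattice.exists_disjoint_and_sup_eq hIB
  have h1 : Disjoint A C := by
    rw [Submodule.disjoint_def] at hC ⊢
    exact fun x hxA hxC => hC x ⟨hxA, hCB ▸ Submodule.mem_sup_right hxC⟩ hxC
  have h2 : Disjoint A (D.map (Φ.symm : V' →ₗ[ℂ] V)) := by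
    rw [Submodule.disjoint_def] at hD ⊢
    rintro x hxA ⟨d, hd, rfl⟩
    have : d ∈ A.map (Φ : V →ₗ[ℂ] V') ⊓ B' :=
      ⟨⟨_, hxA, Φ.apply_symm_apply d⟩, hDB ▸ Submodule.mem_sup_right hd⟩
    simp [hD d (h ▸ this) hd]
  have h3 : finrank ℂ C = finrank ℂ (D.map (Φ.symm : V' →ₗ[ℂ] V)) := by
    have e1 := finrank_sup_of_disjoint hC
    have e2 := finrank_sup_of_disjoint hD
    rw [hCB] at e1
    rw [hDB, LinearEquiv.finrank_map_eq] at e2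
    rw [LinearEquiv.finrank_map_eq]
    omega
  obtain ⟨g, hg, hgC⟩ := exists_equiv_id_on_map_eq h1 h2 h3
  refine ⟨g ≪≫ₗ Φ, fun a ha => by simp [hg a ha], ?_⟩
  rw [← hCB, Submodule.map_sup, ← hDB]
  congr 1
  · exact map_equiv_congr (fun a ha => by simp [hg a ha]) inf_le_left
  · rw [LinearEquiv.coe_trans, Submodule.map_comp, hgC, ← Submodule.map_comp]
    convert Submodule.map_id D
    ext
    simp

/-- Any two configurations of subspaces `Z ≤ T ⊓ Y`, `T`, `Y` with the same dimensions are
related by an isomorphism. -/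
lemma exists_equiv_config (hV : finrank ℂ V = finrank ℂ V') {Z T Y : Submodule ℂ V}
    {Z' T' Y' : Submodule ℂ V'} (hZ : Z ≤ T ⊓ Y) (hZ' : Z' ≤ T' ⊓ Y')
    (eZ : finrank ℂ Z = finrank ℂ Z') (eT : finrank ℂ T = finrank ℂ T')
    (eY : finrank ℂ Y = finrank ℂ Y')
    (eI : finrank ℂ (T ⊓ Y : Submodule ℂ V) = finrank ℂ (T' ⊓ Y' : Submodule ℂ V')) :
    ∃ Φ : V ≃ₗ[ℂ] V', Z.map (Φ : V →ₗ[ℂ] V') = Z' ∧ T.map (Φ : V →ₗ[ℂ] V') = T' ∧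
      Y.map (Φ : V →ₗ[ℂ] V') = Y' := by
  -- The subspaces `Z`, `T ⊓ Y`, `T`, `Y` are matched in this order, so that each one meets the part
  -- already treated in a subspace already matched.
  obtain ⟨Φ₁, -, h₁⟩ := exists_equiv_extend (LinearEquiv.ofFinrankEq V V' hV) (A := ⊥) (by simp) eZ
  obtain ⟨Φ₂, h₂, h₂'⟩ := exists_equiv_extend Φ₁ (A := Z)
    (by rw [h₁, inf_eq_left.2 hZ', inf_eq_left.2 hZ, h₁]) eI
  obtain ⟨Φ₃, h₃, h₃'⟩ := exists_equiv_extend Φ₂ (A := T ⊓ Y) (B := T)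
    (by rw [h₂', inf_eq_left.2 inf_le_left, inf_eq_left.2 inf_le_left, h₂']) eT
  obtain ⟨Φ₄, h₄, h₄'⟩ := exists_equiv_extend Φ₃ (A := T) (B := Y)
    (by rw [h₃', map_equiv_congr h₃ le_rfl, h₂']) eY
  refine ⟨Φ₄, ?_, ?_, h₄'⟩
  · rw [map_equiv_congr h₄ (hZ.trans inf_le_left), map_equiv_congr h₃ hZ,
      map_equiv_congr h₂ le_rfl, h₁]
  · rw [map_equiv_congr h₄ le_rfl, h₃']

omit [FiniteDimensional ℂ V'] in
lemma finrank_map_add_finrank_inf_ker (t : V →ₗ[ℂ] V') (X : Submodule ℂ V) :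
    finrank ℂ (X.map t) + finrank ℂ (LinearMap.ker t ⊓ X : Submodule ℂ V) = finrank ℂ X := by
  have := (t.domRestrict X).finrank_range_add_finrank_ker
  rw [LinearMap.range_domRestrict, LinearMap.ker_domRestrict] at this
  rw [← this, inf_comm, ← Submodule.map_comap_subtype,
    LinearEquiv.finrank_eq (Submodule.equivSubtypeMap X _)]

omit [FiniteDimensional ℂ V] [FiniteDimensional ℂ V'] in
/-- A linear map has a section over its image that is compatible with a given subspace. -/
lemma exists_section (t : V →ₗ[ℂ] V') (X : Submodule ℂ V) :
    ∃ σ : V' →ₗ[ℂ] V, (∀ x, t (σ (t x)) = t x) ∧ ∀ x ∈ X, σ (t x) ∈ X := by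
  -- A complement of `ker t ∩ X` inside `X` is enlarged to a complement of `ker t`; inverting `t` on
  -- the latter gives a section that respects `X`.
  obtain ⟨E, hE, hEX⟩ := IsModularLattice.exists_disjoint_and_sup_eq
    (inf_le_right : LinearMap.ker t ⊓ X ≤ X)
  have hEK : Disjoint E (LinearMap.ker t) := by
    rw [Submodule.disjoint_def] at hE ⊢
    exact fun x hxE hx => hE x ⟨hx, hEX ▸ Submodule.mem_sup_right hxE⟩ hxE
  obtain ⟨L, hEL, hL⟩ := hEK.exists_isCompl
  obtain ⟨l, hl⟩ := (t.domRestrict L).exists_leftInverse_of_injective (by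
    rw [LinearMap.ker_eq_bot']
    exact fun x hx => Subtype.ext (Submodule.disjoint_def.1 hL.disjoint x x.2 hx))
  have hl' : ∀ x ∈ L, l (t x) = x := fun x hx => congrArg Subtype.val (LinearMap.congr_fun hl ⟨x, hx⟩)
  refine ⟨L.subtype ∘ₗ l, fun x => ?_, fun x hx => ?_⟩
  · obtain ⟨y, hy, k, hk, rfl⟩ := Submodule.mem_sup.1 (hL.sup_eq_top ▸ Submodule.mem_top : x ∈ L ⊔ _)
    simp [LinearMap.mem_ker.1 hk, hl' y hy]
  · rw [← hEX] at hx
    obtain ⟨k, hk, y, hy, rfl⟩ := Submodule.mem_sup.1 hx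
    simpa [LinearMap.mem_ker.1 hk.1, hl' y (hEL hy)] using hEX ▸ Submodule.mem_sup_right hy

/-- Pairs `(t, X)` of an operator with square zero and a stable subspace are classified by their
discrete invariants. -/
lemma exists_equiv_conj (hV : finrank ℂ V = finrank ℂ V') {t : End ℂ V} {t' : End ℂ V'}
    (ht : ∀ x, t (t x) = 0) (ht' : ∀ x, t' (t' x) = 0) {X : Submodule ℂ V} {X' : Submodule ℂ V'}
    (hX : X.map t ≤ X) (hX' : X'.map t' ≤ X')
    (eT : finrank ℂ (LinearMap.range t) = finrank ℂ (LinearMap.range t'))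
    (eX : finrank ℂ X = finrank ℂ X') (eZ : finrank ℂ (X.map t) = finrank ℂ (X'.map t'))
    (eI : finrank ℂ (LinearMap.range t ⊓ X : Submodule ℂ V) =
      finrank ℂ (LinearMap.range t' ⊓ X' : Submodule ℂ V')) :
    ∃ Ψ : V ≃ₗ[ℂ] V', (∀ x, Ψ (t x) = t' (Ψ x)) ∧ X.map (Ψ : V →ₗ[ℂ] V') = X' := by
  have hTK : LinearMap.range t ≤ LinearMap.ker t := by rintro _ ⟨x, rfl⟩; exact ht x
  have hTK' : LinearMap.range t' ≤ LinearMap.ker t' := by rintro _ ⟨x, rfl⟩; exact ht' x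
  have hYI : LinearMap.range t ⊓ (LinearMap.ker t ⊓ X) = LinearMap.range t ⊓ X := by
    rw [← inf_assoc, inf_eq_left.2 hTK]
  have hYI' : LinearMap.range t' ⊓ (LinearMap.ker t' ⊓ X') = LinearMap.range t' ⊓ X' := by
    rw [← inf_assoc, inf_eq_left.2 hTK']
  have eY : finrank ℂ (LinearMap.ker t ⊓ X : Submodule ℂ V) =
      finrank ℂ (LinearMap.ker t' ⊓ X' : Submodule ℂ V') := by
    have := finrank_map_add_finrank_inf_ker t X
    have := finrank_map_add_finrank_inf_ker t' X'
    omega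
  obtain ⟨Φ, hΦZ, hΦT, hΦY⟩ := exists_equiv_config hV
    (hYI ▸ le_inf LinearMap.map_le_range hX) (hYI' ▸ le_inf LinearMap.map_le_range hX')
    eZ eT eY (by rw [hYI, hYI', eI])
  obtain ⟨Φ₁, hΦ₁, hΦK⟩ := exists_equiv_extend Φ
    (A := LinearMap.range t ⊔ (LinearMap.ker t ⊓ X)) (B := LinearMap.ker t) (B' := LinearMap.ker t')
    (by
      have h : LinearMap.range t ⊔ (LinearMap.ker t ⊓ X) ≤ LinearMap.ker t :=
        sup_le hTK inf_le_left
      have h' : LinearMap.range t' ⊔ (LinearMap.ker t' ⊓ X') ≤ LinearMap.ker t' :=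
        sup_le hTK' inf_le_left
      rw [inf_eq_left.2 h, Submodule.map_sup, hΦT, hΦY, inf_eq_left.2 h'])
    (by
      have := t.finrank_range_add_finrank_ker
      have := t'.finrank_range_add_finrank_ker
      omega)
  have hZ : ∀ x ∈ X, Φ₁ (t x) ∈ X'.map t' := fun x hx => by
    rw [hΦ₁ _ (Submodule.mem_sup_left ⟨x, rfl⟩), ← hΦZ]
    exact ⟨t x, ⟨x, hx, rfl⟩, rfl⟩
  have hT : ∀ x, Φ₁ (t x) ∈ LinearMap.range t' := fun x => by
    rw [hΦ₁ _ (Submodule.mem_sup_left ⟨x, rfl⟩), ← hΦT]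
    exact ⟨t x, ⟨x, rfl⟩, rfl⟩
  have hK : ∀ x, t x = 0 → t' (Φ₁ x) = 0 := fun x hx => by
    rw [← LinearMap.mem_ker, ← hΦK]
    exact ⟨x, hx, rfl⟩
  have hY : ∀ x ∈ X, t x = 0 → Φ₁ x ∈ X' := fun x hx htx => by
    have : Φ x ∈ LinearMap.ker t' ⊓ X' := hΦY ▸ ⟨x, ⟨htx, hx⟩, rfl⟩
    rw [hΦ₁ _ (Submodule.mem_sup_right ⟨htx, hx⟩)]
    exact this.2
  obtain ⟨σ, hσ, hσX⟩ := exists_section t X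
  obtain ⟨σ', hσ', hσX'⟩ := exists_section t' X'
  have hσt : ∀ x, t' (σ' (Φ₁ (t x))) = Φ₁ (t x) := fun x => by
    obtain ⟨y, hy⟩ := hT x
    rw [← hy, hσ']
  -- `Φ₁` matches the images, the kernels and their intersections with `X`, but need not intertwine
  -- `t` and `t'`. It is kept on the kernel, and on the image of `σ` it is replaced by the lift `σ'`
  -- of `Φ₁ ∘ t`, which forces `t' ∘ ψ = Φ₁ ∘ t`.
  let ψ : V →ₗ[ℂ] V' := Φ₁ ∘ₗ (LinearMap.id - σ ∘ₗ t) + σ' ∘ₗ Φ₁ ∘ₗ t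
  have hψ : ∀ x, ψ x = Φ₁ (x - σ (t x)) + σ' (Φ₁ (t x)) := fun x => rfl
  have hψt : ∀ x, t' (ψ x) = Φ₁ (t x) := fun x => by
    rw [hψ, map_add, hK _ (by rw [map_sub, hσ, sub_self]), zero_add, hσt]
  have hinj : Function.Injective ψ := by
    rw [injective_iff_map_eq_zero]
    intro x hx
    have h1 : t x = 0 := by
      have := hψt x
      rw [hx, map_zero] at this
      exact Φ₁.map_eq_zero_iff.1 this.symm
    rw [hψ, h1] at hx
    simpa using hx
  let Ψ : V ≃ₗ[ℂ] V' := LinearEquiv.ofBijective ψ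
    ⟨hinj, (LinearMap.injective_iff_surjective_of_finrank_eq_finrank hV).1 hinj⟩
  refine ⟨Ψ, fun x => ?_, ?_⟩
  · change ψ (t x) = t' (ψ x)
    rw [hψt, hψ, ht]
    simp
  · refine Submodule.eq_of_le_of_finrank_eq ?_ (by rw [LinearEquiv.finrank_map_eq, eX])
    rintro _ ⟨x, hx, rfl⟩
    change ψ x ∈ X'
    rw [hψ]
    refine X'.add_mem (hY _ (X.sub_mem hx (hσX x hx)) (by rw [map_sub, hσ, sub_self])) ?_
    obtain ⟨y, hy, hy'⟩ := hZ x hx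
    exact hy' ▸ hσX' y hy

end LinearAlgebra

/-! ### Discrete invariants of a triple and their inequalities. -/

section Invariants

variable {n : ℕ} {w1 r1 r2 : ℕ} {t : End ℂ (Vec n)} {X F : Gr n}

/-- The image of `t` on the quotient by `X` is `im t / (im t ∩ X)`, so both rank conditions become
dimensions of subspaces of the ambient space. -/
lemma compatible_iff : Compatible w1 r1 r2 t X ↔ finrank ℂ X = w1 ∧ X.map t ≤ X ∧
    finrank ℂ (X.map t) = r1 ∧
    finrank ℂ (LinearMap.range t) = r2 + finrank ℂ (LinearMap.range t ⊓ X : Gr n) := by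
  refine and_congr_right fun _ => ?_
  have h1 (h : X ≤ X.comap t) :
      finrank ℂ (LinearMap.range (t.restrict h)) = finrank ℂ (X.map t) := by
    rw [← LinearMap.range_domRestrict, ← Submodule.finrank_map_subtype_eq X, ← LinearMap.range_comp]
    rfl
  have h2 (h : X ≤ X.comap t) : finrank ℂ (LinearMap.range (X.mapQ X t h)) +
      finrank ℂ (LinearMap.range t ⊓ X : Gr n) = finrank ℂ (LinearMap.range t) := by
    rw [Submodule.range_mapQ, ← finrank_map_add_finrank_inf_ker X.mkQ (LinearMap.range t),
      Submodule.ker_mkQ, inf_comm]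
  constructor
  · rintro ⟨h, h3, h4⟩
    exact ⟨Submodule.map_le_iff_le_comap.2 h, h1 h ▸ h3, by have := h2 h; omega⟩
  · rintro ⟨h, h3, h4⟩
    have h := Submodule.map_le_iff_le_comap.1 h
    exact ⟨h, h1 h ▸ h3, by have := h2 h; omega⟩

lemma range_le_ker_of_mem_N2 (ht : t ∈ N2 n) : LinearMap.range t ≤ LinearMap.ker t := by
  rintro _ ⟨x, rfl⟩
  exact LinearMap.congr_fun (show t * t = 0 from ht) x

lemma finrank_quotient_submoduleOf {v1 v2 : ℕ} (h : finrank ℂ (F ⊓ X : Gr n) = v1) :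
    finrank ℂ (F ⧸ (F ⊓ X).submoduleOf F) = v2 ↔ finrank ℂ F = v1 + v2 := by
  have h1 := ((F ⊓ X).submoduleOf F).finrank_quotient_add_finrank
  have h2 := LinearEquiv.finrank_eq (Submodule.submoduleOfEquivOfLe (inf_le_left : F ⊓ X ≤ F))
  omega

/-- The inequalities between the discrete invariants of a point `(t, X, F)`. -/
lemma invariants_le {w2 : ℕ} (hn : n = w1 + w2) (hTF : LinearMap.range t ≤ F)
    (hFK : F ≤ LinearMap.ker t) (hc : Compatible w1 r1 r2 t X) :
    r1 ≤ finrank ℂ (F ⊓ X : Gr n) ∧ finrank ℂ (F ⊓ X : Gr n) + r1 ≤ w1 ∧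
    finrank ℂ (F ⊓ X : Gr n) + r2 ≤ finrank ℂ F ∧
    finrank ℂ F + r2 ≤ w2 + finrank ℂ (F ⊓ X : Gr n) ∧
    finrank ℂ (LinearMap.range t) ≤ finrank ℂ (F ⊓ X : Gr n) + r2 ∧
    finrank ℂ (LinearMap.range t) + finrank ℂ F ≤ w2 + r1 + finrank ℂ (F ⊓ X : Gr n) ∧
    r1 + r2 ≤ finrank ℂ (LinearMap.range t) := by
  obtain ⟨h1, h2, h3, h4⟩ := compatible_iff.1 hc
  -- Everything follows from the chain `tX ⊆ im t ∩ X ⊆ F ∩ X ⊆ ker t ∩ X`, the analogous chain of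
  -- sums with `X`, and dimension formulas.
  have a1 : finrank ℂ (X.map t) ≤ finrank ℂ (LinearMap.range t ⊓ X : Gr n) :=
    Submodule.finrank_mono (le_inf LinearMap.map_le_range h2)
  have a2 : finrank ℂ (LinearMap.range t ⊓ X : Gr n) ≤ finrank ℂ (F ⊓ X : Gr n) :=
    Submodule.finrank_mono (inf_le_inf_right _ hTF)
  have a3 : finrank ℂ (F ⊓ X : Gr n) ≤ finrank ℂ (LinearMap.ker t ⊓ X : Gr n) :=
    Submodule.finrank_mono (inf_le_inf_right _ hFK)
  have a4 := finrank_map_add_finrank_inf_ker t X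
  have a5 := Submodule.finrank_sup_add_finrank_inf_eq (LinearMap.ker t) X
  have a6 := Submodule.finrank_sup_add_finrank_inf_eq F X
  have a7 := Submodule.finrank_sup_add_finrank_inf_eq (LinearMap.range t) X
  have a8 : finrank ℂ (LinearMap.range t ⊔ X : Gr n) ≤ finrank ℂ (F ⊔ X : Gr n) :=
    Submodule.finrank_mono (sup_le_sup_right hTF _)
  have a9 : finrank ℂ (F ⊔ X : Gr n) ≤ finrank ℂ (LinearMap.ker t ⊔ X : Gr n) :=
    Submodule.finrank_mono (sup_le_sup_right hFK _)
  have a10 := t.finrank_range_add_finrank_ker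
  rw [finrank_fin_fun] at a10
  omega

end Invariants

/-! ### Inclusions and projections as polynomial maps. -/

section PolyMap

variable {V V₁ : Type} [AddCommGroup V] [Module ℂ V] [AddCommGroup V₁] [Module ℂ V₁]

lemma isPolyMap_subtype (p : Submodule ℂ V) : IsPolyMap fun x : p => (x : V) :=
  isPolyMap_linear p.subtype

lemma isPolyMap_fst : IsPolyMap fun x : V × V₁ => x.1 :=
  isPolyMap_linear (LinearMap.fst ℂ V V₁)

lemma isPolyMap_snd : IsPolyMap fun x : V × V₁ => x.2 :=
  isPolyMap_linear (LinearMap.snd ℂ V V₁)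

end PolyMap

/-! ### Conjugation up to a scalar, centralizer orbits and the strata by rank. -/

section Conjugation

variable {n : ℕ} {t t' : End ℂ (Vec n)} {Ψ : Vec n ≃ₗ[ℂ] Vec n} {c : ℂ}

/-- The scalar `c` is allowed because conjugation through the adjugate is only correct up to a
factor; images and kernels do not see it. -/
lemma map_map_of_conj (hc : c ≠ 0) (h : ∀ x, Ψ (t x) = c • t' (Ψ x)) (X : Gr n) :
    (X.map (Ψ : Vec n →ₗ[ℂ] Vec n)).map t' = (X.map t).map (Ψ : Vec n →ₗ[ℂ] Vec n) := by
  rw [← Submodule.map_comp, ← Submodule.map_comp, ← Submodule.map_smul _ _ c hc]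
  congr 1
  exact LinearMap.ext fun x => (h x).symm

lemma range_of_conj (hc : c ≠ 0) (h : ∀ x, Ψ (t x) = c • t' (Ψ x)) :
    LinearMap.range t' = (LinearMap.range t).map (Ψ : Vec n →ₗ[ℂ] Vec n) := by
  rw [LinearMap.range_eq_map t, ← map_map_of_conj hc h, Submodule.map_top, LinearEquiv.range,
    Submodule.map_top]

lemma ker_of_conj (hc : c ≠ 0) (h : ∀ x, Ψ (t x) = c • t' (Ψ x)) :
    LinearMap.ker t' = (LinearMap.ker t).map (Ψ : Vec n →ₗ[ℂ] Vec n) := by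
  ext x
  rw [Submodule.mem_map_equiv, LinearMap.mem_ker, LinearMap.mem_ker,
    ← Ψ.map_eq_zero_iff (x := t _), h, Ψ.apply_symm_apply, smul_eq_zero_iff_right hc]

lemma mem_N2_of_conj (hc : c ≠ 0) (h : ∀ x, Ψ (t x) = c • t' (Ψ x)) (ht : t ∈ N2 n) :
    t' ∈ N2 n := by
  have h1 : LinearMap.range t' ≤ LinearMap.ker t' := by
    rw [range_of_conj hc h, ker_of_conj hc h]
    exact Submodule.map_mono (range_le_ker_of_mem_N2 ht)
  exact LinearMap.ext fun x => h1 ⟨x, rfl⟩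

lemma Compatible.conj {w1 r1 r2 : ℕ} {X : Gr n} (hX : Compatible w1 r1 r2 t X) (hc : c ≠ 0)
    (h : ∀ x, Ψ (t x) = c • t' (Ψ x)) :
    Compatible w1 r1 r2 t' (X.map (Ψ : Vec n →ₗ[ℂ] Vec n)) := by
  rw [compatible_iff] at hX ⊢
  rw [map_map_of_conj hc h, range_of_conj hc h, ← Submodule.map_inf _ Ψ.injective]
  simp only [LinearEquiv.finrank_map_eq]
  exact ⟨hX.1, Submodule.map_mono hX.2.1, hX.2.2⟩

lemma mem_M2tot_of_conj {F : Gr n} (hF : (t, F) ∈ M2tot n) (hc : c ≠ 0)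
    (h : ∀ x, Ψ (t x) = c • t' (Ψ x)) : (t', F.map (Ψ : Vec n →ₗ[ℂ] Vec n)) ∈ M2tot n := by
  refine ⟨mem_N2_of_conj hc h hF.1, ?_, ?_⟩
  · change LinearMap.range t' ≤ _
    rw [range_of_conj hc h]
    exact Submodule.map_mono hF.2.1
  · change _ ≤ LinearMap.ker t'
    rw [ker_of_conj hc h]
    exact Submodule.map_mono hF.2.2

lemma mem_O2_of_conj {r : ℕ} (ht : t ∈ O2 n r) (hc : c ≠ 0)
    (h : ∀ x, Ψ (t x) = c • t' (Ψ x)) : t' ∈ O2 n r := by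
  refine ⟨mem_N2_of_conj hc h ht.1, ?_⟩
  rw [range_of_conj hc h, LinearEquiv.finrank_map_eq, ht.2]

lemma mem_T2_of_conj {w1 r1 w2 r2 : ℕ} {t t' : End ℂ (Vec (w1 + w2))}
    {Ψ : Vec (w1 + w2) ≃ₗ[ℂ] Vec (w1 + w2)} {X F : Gr (w1 + w2)}
    (hx : ⟨t, X, F⟩ ∈ T2 w1 r1 w2 r2) (hc : c ≠ 0) (h : ∀ x, Ψ (t x) = c • t' (Ψ x)) :
    ⟨t', X.map (Ψ : _ →ₗ[ℂ] Vec (w1 + w2)), F.map (Ψ : _ →ₗ[ℂ] Vec (w1 + w2))⟩ ∈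
      T2 w1 r1 w2 r2 :=
  ⟨mem_M2tot_of_conj hx.1 hc h, hx.2.conj hc h⟩

lemma mem_T2vv_iff {v1 w1 r1 v2 w2 r2 : ℕ} {x : Triple (w1 + w2)} :
    x ∈ T2vv v1 w1 r1 v2 w2 r2 ↔ x ∈ T2 w1 r1 w2 r2 ∧ finrank ℂ (x.F ⊓ x.X : Gr (w1 + w2)) = v1 ∧
      finrank ℂ x.F = v1 + v2 :=
  and_congr_right fun _ => and_congr_right fun h => finrank_quotient_submoduleOf h

lemma mem_T2vv_of_conj {v1 w1 r1 v2 w2 r2 : ℕ} {t t' : End ℂ (Vec (w1 + w2))}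
    {Ψ : Vec (w1 + w2) ≃ₗ[ℂ] Vec (w1 + w2)} {X F : Gr (w1 + w2)}
    (hx : ⟨t, X, F⟩ ∈ T2vv v1 w1 r1 v2 w2 r2) (hc : c ≠ 0) (h : ∀ x, Ψ (t x) = c • t' (Ψ x)) :
    ⟨t', X.map (Ψ : _ →ₗ[ℂ] Vec (w1 + w2)), F.map (Ψ : _ →ₗ[ℂ] Vec (w1 + w2))⟩ ∈
      T2vv v1 w1 r1 v2 w2 r2 := by
  rw [mem_T2vv_iff] at hx ⊢
  refine ⟨mem_T2_of_conj hx.1 hc h, ?_⟩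
  have h1 := Submodule.map_inf (Ψ : _ →ₗ[ℂ] Vec (w1 + w2)) Ψ.injective (p := F) (q := X)
  change finrank ℂ (F.map (Ψ : _ →ₗ[ℂ] Vec (w1 + w2)) ⊓ X.map (Ψ : _ →ₗ[ℂ] Vec (w1 + w2)) :
    Gr (w1 + w2)) = _ ∧ finrank ℂ (F.map (Ψ : _ →ₗ[ℂ] Vec (w1 + w2))) = _
  rw [← h1, LinearEquiv.finrank_map_eq, LinearEquiv.finrank_map_eq]
  exact hx.2

/-- An operator with nonzero determinant as an automorphism. -/
def autOfDet (g : End ℂ (Vec n)) (hg : LinearMap.det g ≠ 0) : Vec n ≃ₗ[ℂ] Vec n :=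
  LinearMap.equivOfDetNeZero g hg

lemma det_coe_ne_zero (Ψ : Vec n ≃ₗ[ℂ] Vec n) : LinearMap.det (Ψ : End ℂ (Vec n)) ≠ 0 :=
  Ψ.isUnit_det'.ne_zero

lemma conj_adj (g : End ℂ (Vec n)) (t : End ℂ (Vec n)) (x : Vec n) :
    (g ∘ₗ t ∘ₗ adj g) (g x) = LinearMap.det g • g (t x) := by
  have := LinearMap.congr_fun (adj_comp g) x
  simp only [LinearMap.comp_apply, LinearMap.smul_apply, LinearMap.id_apply] at this ⊢
  rw [this, map_smul, map_smul]

lemma eq_conj_adj (h : ∀ x, Ψ (t x) = c • t' (Ψ x)) (hc : c ≠ 0) :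
    t' = (c * LinearMap.det (Ψ : End ℂ (Vec n)))⁻¹ •
      ((Ψ : End ℂ (Vec n)) ∘ₗ t ∘ₗ adj (Ψ : End ℂ (Vec n))) := by
  refine LinearMap.ext fun x => ?_
  obtain ⟨y, rfl⟩ := Ψ.surjective x
  have h1 := conj_adj (Ψ : End ℂ (Vec n)) t y
  have h2 := det_coe_ne_zero Ψ
  rw [LinearEquiv.coe_coe, h] at h1
  rw [LinearMap.smul_apply, h1, smul_smul, smul_smul, mul_right_comm, mul_assoc,
    inv_mul_cancel₀ (mul_ne_zero hc h2), one_smul]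

/-- The subspace `X` as the span of a family that depends on `X` only. -/
def basisFamily (X : Gr n) (i : Fin (finrank ℂ X)) : Vec n := finBasis ℂ X i

lemma span_map_basisFamily (X : Gr n) (g : End ℂ (Vec n)) :
    Submodule.span ℂ (Set.range fun i => g (basisFamily X i)) = X.map g := by
  have h : (fun i => g (basisFamily X i)) = (g ∘ₗ X.subtype) ∘ (finBasis ℂ X) := rfl
  rw [h, Set.range_comp, ← Submodule.map_span, Basis.span_eq, Submodule.map_comp,
    Submodule.map_top, Submodule.range_subtype]

lemma linearIndependent_map_basisFamily (X : Gr n) {g : End ℂ (Vec n)}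
    (hg : LinearMap.det g ≠ 0) : LinearIndependent ℂ fun i => g (basisFamily X i) := by
  have h : (fun i => g (basisFamily X i)) = (g ∘ₗ X.subtype) ∘ (finBasis ℂ X) := rfl
  rw [h]
  refine (finBasis ℂ X).linearIndependent.map' _ ?_
  rw [LinearMap.ker_eq_bot]
  exact (autOfDet g hg).injective.comp X.injective_subtype

/-- The operators commuting with `t`. -/
def centralizer (t : End ℂ (Vec n)) : Submodule ℂ (End ℂ (Vec n)) :=
  LinearMap.ker (LinearMap.mulLeft ℂ t - LinearMap.mulRight ℂ t)

lemma mem_centralizer {h : End ℂ (Vec n)} : h ∈ centralizer t ↔ ∀ x, h (t x) = t (h x) := by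
  rw [centralizer, LinearMap.mem_ker, LinearMap.sub_apply, sub_eq_zero, eq_comm]
  exact LinearMap.ext_iff

/-- The translates of a subspace by the automorphisms commuting with `t` form an irreducible set. -/
lemma isPreirreducible_centralizer_orbit (t : End ℂ (Vec n)) (X : Gr n) :
    IsPreirreducible ((fun h : centralizer t => X.map h.1) ''
      {h | LinearMap.det h.1 ≠ 0}) := by
  have h1 : IsPolyMap fun h : centralizer t => h.1 := isPolyMap_subtype _
  have h2 : IsPolyMap fun (h : centralizer t) i => h.1 (basisFamily X i) :=
    IsPolyMap.pi fun i => h1.apply (basisFamily X i)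
  -- Commuting with `t` is a linear condition, so the invertible elements of the centralizer form an
  -- open subset of a vector space.
  have hU : IsOpen[zariski (centralizer t)] {h : centralizer t | LinearMap.det h.1 ≠ 0} :=
    isOpen_ne_zero h1.det
  have := isPreirreducible_gr_image hU h2
    (fun h hh => linearIndependent_map_basisFamily X (g := h.1) hh)
  simpa only [span_map_basisFamily] using this

/-- This is the classification of stable pairs with `F` as the stable subspace: here `tF = 0` and
`im t ∩ F = im t`, so only the rank and `dim F` remain as invariants. -/
lemma exists_equiv_conj_of_mem_M2 {w r : ℕ} {t t' : End ℂ (Vec w)} {F F' : Gr w}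
    (hF : F ∈ M2 w r t) (hF' : F' ∈ M2 w r t') (h : finrank ℂ F = finrank ℂ F') :
    ∃ Ψ : Vec w ≃ₗ[ℂ] Vec w, (∀ x, Ψ (t x) = t' (Ψ x)) ∧
      F.map (Ψ : Vec w →ₗ[ℂ] Vec w) = F' := by
  have h0 {t : End ℂ (Vec w)} {F : Gr w} (hF : F ∈ M2 w r t) : F.map t = ⊥ := by
    rw [eq_bot_iff]
    rintro _ ⟨x, hx, rfl⟩
    exact hF.2.2.2 hx
  refine exists_equiv_conj rfl (LinearMap.congr_fun hF.1.1) (LinearMap.congr_fun hF'.1.1)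
    (by rw [h0 hF]; exact bot_le) (by rw [h0 hF']; exact bot_le) (hF.1.2.trans hF'.1.2.symm) h
    (by rw [h0 hF, h0 hF']) ?_
  rw [inf_eq_left.2 hF.2.2.1, inf_eq_left.2 hF'.2.2.1, hF.1.2, hF'.1.2]

lemma exists_equiv_conj_of_compatible {w1 r1 r2 r : ℕ} {t t' : End ℂ (Vec n)} {X X' : Gr n}
    (ht : t ∈ O2 n r) (ht' : t' ∈ O2 n r)
    (hX : Compatible w1 r1 r2 t X) (hX' : Compatible w1 r1 r2 t' X') :
    ∃ Ψ : Vec n ≃ₗ[ℂ] Vec n, (∀ x, Ψ (t x) = t' (Ψ x)) ∧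
      X.map (Ψ : Vec n →ₗ[ℂ] Vec n) = X' := by
  rw [compatible_iff] at hX hX'
  obtain ⟨h1, h2⟩ := ht
  obtain ⟨h1', h2'⟩ := ht'
  exact exists_equiv_conj rfl (LinearMap.congr_fun h1) (LinearMap.congr_fun h1') hX.2.1 hX'.2.1
    (h2.trans h2'.symm) (by omega) (by omega) (by omega)

lemma smul_one_conj {h : centralizer t} (hh : LinearMap.det h.1 ≠ 0) (x : Vec n) :
    autOfDet h.1 hh (t x) = (1 : ℂ) • t (autOfDet h.1 hh x) := by
  rw [one_smul]; exact mem_centralizer.1 h.2 x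

lemma isPreirreducible_M2v (v w r : ℕ) (t : End ℂ (Vec w)) : IsPreirreducible (M2v v w r t) := by
  rcases (M2v v w r t).eq_empty_or_nonempty with h | ⟨F₀, hF₀, hv⟩
  · rw [h]; exact isPreirreducible_empty
  convert isPreirreducible_centralizer_orbit t F₀
  ext F
  constructor
  · rintro ⟨hF, hv'⟩
    obtain ⟨Ψ, h1, h2⟩ := exists_equiv_conj_of_mem_M2 hF₀ hF (hv.trans hv'.symm)
    exact ⟨⟨Ψ, mem_centralizer.2 h1⟩, det_coe_ne_zero Ψ, h2⟩
  · rintro ⟨h, hh, rfl⟩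
    refine ⟨⟨hF₀.1, mem_M2tot_of_conj hF₀.2 one_ne_zero (smul_one_conj hh)⟩, ?_⟩
    rw [← hv]
    exact LinearEquiv.finrank_map_eq (autOfDet h.1 hh) F₀

lemma isPreirreducible_S2 (w1 r1 w2 r2 r : ℕ) (t : End ℂ (Vec (w1 + w2))) :
    IsPreirreducible (S2 w1 r1 w2 r2 r t) := by
  rcases (S2 w1 r1 w2 r2 r t).eq_empty_or_nonempty with h | ⟨X₀, ht, hX₀⟩
  · rw [h]; exact isPreirreducible_empty
  convert isPreirreducible_centralizer_orbit t X₀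
  ext X
  constructor
  · rintro ⟨-, hX⟩
    obtain ⟨Ψ, h1, h2⟩ := exists_equiv_conj_of_compatible ht ht hX₀ hX
    exact ⟨⟨Ψ, mem_centralizer.2 h1⟩, det_coe_ne_zero Ψ, h2⟩
  · rintro ⟨h, hh, rfl⟩
    exact ⟨ht, hX₀.conj one_ne_zero (smul_one_conj hh)⟩

/-- From one point `(t, X, F)` all others arise as `(c • g t adj(g), gX, ghF)` with `g` invertible,
`h` invertible in the centralizer of `t`, and `c` a nonzero scalar: `g` moves the pair `(t, X)`, and
`h` adjusts `F` beforehand. -/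
lemma isPreirreducible_T2vr (v w1 r1 w2 r2 r : ℕ) :
    IsPreirreducible (T2vr v w1 r1 w2 r2 r) := by
  rcases (T2vr v w1 r1 w2 r2 r).eq_empty_or_nonempty with h | ⟨⟨t, X, F⟩, hT, hv, ht⟩
  · rw [h]; exact isPreirreducible_empty
  let W := ℂ × End ℂ (Vec (w1 + w2)) × centralizer t
  have p1 : IsPolyMap fun x : W => x.1 := isPolyMap_fst
  have p2 : IsPolyMap fun x : W => x.2.1 :=
    isPolyMap_fst.comp isPolyMap_snd
  have p3 : IsPolyMap fun x : W => x.2.2.1 :=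
    (isPolyMap_subtype _).comp (isPolyMap_snd.comp isPolyMap_snd)
  have q1 : IsPolyMap fun x : W => x.1 • (x.2.1 ∘ₗ t ∘ₗ adj x.2.1) :=
    p1.smul (p2.linComp ((isPolyMap_const t).linComp p2.adj))
  have q2 : IsPolyMap fun (x : W) i => x.2.1 (basisFamily X i) :=
    IsPolyMap.pi fun i => p2.apply (basisFamily X i)
  have q3 : IsPolyMap fun (x : W) i => (x.2.1 ∘ₗ x.2.2.1) (basisFamily F i) :=
    IsPolyMap.pi fun i => (p2.linComp p3).apply (basisFamily F i)
  have hU := isOpen_ne_zero ((polyFun W).mul_mem (isPolyMap_iff_mem.1 p1)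
    ((polyFun W).mul_mem p2.det p3.det))
  have hU' : ∀ x ∈ {x : W | ((fun x : W => x.1) * ((fun x : W => LinearMap.det x.2.1) *
      fun x : W => LinearMap.det x.2.2.1)) x ≠ 0},
      x.1 ≠ 0 ∧ LinearMap.det x.2.1 ≠ 0 ∧ LinearMap.det x.2.2.1 ≠ 0 := fun x hx => by
    simpa [not_or] using hx
  have hdet : ∀ {x : W}, LinearMap.det x.2.1 ≠ 0 ∧ LinearMap.det x.2.2.1 ≠ 0 →
      LinearMap.det (x.2.1 ∘ₗ x.2.2.1) ≠ 0 := fun {x} hx => by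
    rw [LinearMap.det_comp]; exact mul_ne_zero hx.1 hx.2
  have := isPreirreducible_triple_image hU q1 q2 q3
    (fun x hx => linearIndependent_map_basisFamily X (hU' x hx).2.1)
    (fun x hx => linearIndependent_map_basisFamily F (hdet (hU' x hx).2))
  simp only [span_map_basisFamily] at this
  convert this
  ext ⟨t', X', F'⟩
  constructor
  · rintro ⟨hT', hv', ht'⟩
    obtain ⟨Ψ, h1, rfl⟩ := exists_equiv_conj_of_compatible ht ht' hT.2 hT'.2
    have h2 : ∀ x, Ψ.symm (t' x) = (1 : ℂ) • t (Ψ.symm x) := fun x => by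
      rw [one_smul, Ψ.symm_apply_eq, h1, Ψ.apply_symm_apply]
    have h3 := mem_M2tot_of_conj hT'.1 one_ne_zero h2
    obtain ⟨h, h4, h5⟩ := exists_equiv_conj_of_mem_M2 ⟨ht, hT.1⟩ ⟨ht, h3⟩
      (by rw [LinearEquiv.finrank_map_eq]; exact hv.trans hv'.symm)
    -- This scalar cancels the determinant that the adjugate introduces.
    refine ⟨⟨(1 * LinearMap.det (Ψ : End ℂ (Vec (w1 + w2))))⁻¹, Ψ, h, mem_centralizer.2 h4⟩, ?_, ?_⟩
    · simp [det_coe_ne_zero]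
    · ext1
      · exact (eq_conj_adj (fun x => by rw [h1, one_smul]) one_ne_zero).symm
      · rfl
      · change F.map ((Ψ : End ℂ (Vec (w1 + w2))) ∘ₗ (h : End ℂ (Vec (w1 + w2)))) = F'
        rw [Submodule.map_comp, h5, ← Submodule.map_comp]
        convert Submodule.map_id F'
        ext
        simp
  · rintro ⟨⟨c, g, h⟩, hx, hx'⟩
    obtain ⟨hc, hg, hh⟩ := hU' _ hx
    have h1 : ∀ x, autOfDet g hg (t x) = (c * LinearMap.det g)⁻¹ •
        (c • (g ∘ₗ t ∘ₗ adj g)) (autOfDet g hg x) := fun x => by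
      change g (t x) = _ • c • (g ∘ₗ t ∘ₗ adj g) (g x)
      rw [conj_adj, smul_smul, smul_smul, mul_assoc, inv_mul_cancel₀ (mul_ne_zero hc hg), one_smul]
    have hc' : (c * LinearMap.det g)⁻¹ ≠ 0 := inv_ne_zero (mul_ne_zero hc hg)
    have h2 := mem_M2tot_of_conj hT.1 one_ne_zero (smul_one_conj hh)
    have h3 := mem_T2_of_conj (F := F.map (autOfDet h.1 hh : _ →ₗ[ℂ] Vec (w1 + w2)))
      ⟨h2, hT.2⟩ hc' h1
    rw [← Submodule.map_comp] at h3
    rw [← hx']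
    refine ⟨h3, ?_, mem_O2_of_conj ht hc' h1⟩
    have e : F.map (g ∘ₗ h.1) = (F.map (autOfDet h.1 hh : _ →ₗ[ℂ] Vec (w1 + w2))).map
        (autOfDet g hg : _ →ₗ[ℂ] Vec (w1 + w2)) := by
      rw [← Submodule.map_comp]; rfl
    rw [← hv]
    change finrank ℂ (F.map (g ∘ₗ h.1)) = _
    rw [e, LinearEquiv.finrank_map_eq, LinearEquiv.finrank_map_eq]

end Conjugation

/-! ### Linear maps of prescribed rank. -/

section Rank

variable {V V' : Type} [AddCommGroup V] [Module ℂ V] [FiniteDimensional ℂ V]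
  [AddCommGroup V'] [Module ℂ V'] [FiniteDimensional ℂ V']

omit [FiniteDimensional ℂ V] [FiniteDimensional ℂ V'] in
lemma finrank_map_of_injective {f : V →ₗ[ℂ] V'} (hf : Function.Injective f) (p : Submodule ℂ V) :
    finrank ℂ (p.map f) = finrank ℂ p :=
  (LinearEquiv.finrank_eq (Submodule.equivMapOfInjective f hf p)).symm

omit [FiniteDimensional ℂ V] [FiniteDimensional ℂ V'] in
lemma finrank_range_comp_of_le {k : ℕ} {M : Vec k →ₗ[ℂ] V'} {N : V →ₗ[ℂ] Vec k}
    (hM : k ≤ finrank ℂ (LinearMap.range M)) (hN : k ≤ finrank ℂ (LinearMap.range N)) :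
    finrank ℂ (LinearMap.range (M ∘ₗ N)) = k := by
  have h1 : LinearMap.range N = ⊤ := Submodule.eq_top_of_finrank_eq
    (le_antisymm (Submodule.finrank_le _) (by rwa [finrank_fin_fun]))
  have h2 := LinearMap.finrank_range_le M
  rw [finrank_fin_fun] at h2
  rw [LinearMap.range_comp_of_range_eq_top M h1]
  omega

omit [FiniteDimensional ℂ V] in
-- Having rank exactly `k` is not an open condition, but such maps are the products of two factors
-- of full rank `k`, and the pairs of such factors form an open subset of a vector space.
lemma exists_comp_of_finrank_range {k : ℕ} {f : V →ₗ[ℂ] V'}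
    (hf : finrank ℂ (LinearMap.range f) = k) :
    ∃ (M : Vec k →ₗ[ℂ] V') (N : V →ₗ[ℂ] Vec k), f = M ∘ₗ N ∧
      k ≤ finrank ℂ (LinearMap.range M) ∧ k ≤ finrank ℂ (LinearMap.range N) := by
  let e : LinearMap.range f ≃ₗ[ℂ] Vec k := LinearEquiv.ofFinrankEq _ _ (by rw [hf, finrank_fin_fun])
  refine ⟨(LinearMap.range f).subtype ∘ₗ e.symm.toLinearMap, e.toLinearMap ∘ₗ f.rangeRestrict,
    ?_, ?_, ?_⟩
  · ext x; simp
  · rw [LinearMap.range_comp_of_range_eq_top _ e.symm.range, Submodule.range_subtype, hf]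
  · rw [LinearMap.range_comp_of_range_eq_top _ f.range_rangeRestrict, e.range, finrank_top,
      finrank_fin_fun]

omit [FiniteDimensional ℂ V] [FiniteDimensional ℂ V'] in
lemma exists_finrank_range_eq {k : ℕ} (h : k ≤ finrank ℂ V) (h' : k ≤ finrank ℂ V') :
    ∃ f : V →ₗ[ℂ] V', finrank ℂ (LinearMap.range f) = k := by
  obtain ⟨u, hu⟩ := exists_linearIndependent_of_le_finrank h
  obtain ⟨u', hu'⟩ := exists_linearIndependent_of_le_finrank h'
  obtain ⟨l, hl⟩ := (Fintype.linearCombination ℂ u).exists_leftInverse_of_injective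
    (LinearMap.ker_eq_bot.2 hu.fintypeLinearCombination_injective)
  refine ⟨Fintype.linearCombination ℂ u' ∘ₗ l, ?_⟩
  have hl' : LinearMap.range l = ⊤ :=
    LinearMap.range_eq_top.2 fun x => ⟨_, LinearMap.congr_fun hl x⟩
  rw [LinearMap.range_comp_of_range_eq_top _ hl', LinearMap.finrank_range_of_inj
    hu'.fintypeLinearCombination_injective, finrank_fin_fun]

end Rank

/-! ### Block operators on the standard space. -/

section Model

/-- The standard space for a pair of subspaces in given relative position. -/
abbrev Mod (p q r s : ℕ) : Type := (Vec p × Vec q) × (Vec r × Vec s)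

variable {p q r s : ℕ}

/-- The operator with the blocks `a`, `b`, `c`. -/
def blk (a : Vec q →ₗ[ℂ] Vec p) (b : Vec s →ₗ[ℂ] Vec p) (c : Vec s →ₗ[ℂ] Vec r) :
    End ℂ (Mod p q r s) :=
  (LinearMap.inl ℂ _ _ ∘ₗ LinearMap.inl ℂ _ _) ∘ₗ (a ∘ₗ (LinearMap.snd ℂ _ _ ∘ₗ LinearMap.fst ℂ _ _) +
    b ∘ₗ (LinearMap.snd ℂ _ _ ∘ₗ LinearMap.snd ℂ _ _)) +
  (LinearMap.inr ℂ _ _ ∘ₗ LinearMap.inl ℂ _ _) ∘ₗ c ∘ₗ (LinearMap.snd ℂ _ _ ∘ₗ LinearMap.snd ℂ _ _)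

lemma blk_apply (a : Vec q →ₗ[ℂ] Vec p) (b : Vec s →ₗ[ℂ] Vec p) (c : Vec s →ₗ[ℂ] Vec r)
    (x : Mod p q r s) : blk a b c x = ((a x.1.2 + b x.2.2, 0), (c x.2.2, 0)) := by
  simp [blk]

lemma IsPolyMap.blk {W : Type} [AddCommGroup W] [Module ℂ W] {a : W → Vec q →ₗ[ℂ] Vec p}
    {b : W → Vec s →ₗ[ℂ] Vec p} {c : W → Vec s →ₗ[ℂ] Vec r} (ha : IsPolyMap a) (hb : IsPolyMap b)
    (hc : IsPolyMap c) : IsPolyMap fun x => blk (a x) (b x) (c x) :=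
  ((isPolyMap_const _).linComp ((ha.linComp (isPolyMap_const _)).add
    (hb.linComp (isPolyMap_const _)))).add
    ((isPolyMap_const _).linComp (hc.linComp (isPolyMap_const _)))

/-- The first standard subspace. -/
def modX (p q r s : ℕ) : Submodule ℂ (Mod p q r s) := LinearMap.range (LinearMap.inl ℂ _ _)

/-- The second standard subspace. -/
def modF (p q r s : ℕ) : Submodule ℂ (Mod p q r s) :=
  LinearMap.range ((LinearMap.inl ℂ (Vec p) (Vec q)).prodMap (LinearMap.inl ℂ (Vec r) (Vec s)))

lemma mem_modX {x : Mod p q r s} : x ∈ modX p q r s ↔ x.2 = 0 := by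
  constructor
  · rintro ⟨y, rfl⟩; rfl
  · intro h; exact ⟨x.1, Prod.ext rfl h.symm⟩

lemma mem_modF {x : Mod p q r s} : x ∈ modF p q r s ↔ x.1.2 = 0 ∧ x.2.2 = 0 := by
  constructor
  · rintro ⟨y, rfl⟩; exact ⟨rfl, rfl⟩
  · intro h; exact ⟨(x.1.1, x.2.1), Prod.ext (Prod.ext rfl h.1.symm) (Prod.ext rfl h.2.symm)⟩

lemma finrank_modX : finrank ℂ (modX p q r s) = p + q := by
  rw [modX, LinearMap.finrank_range_of_inj LinearMap.inl_injective]
  simp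

lemma finrank_modF : finrank ℂ (modF p q r s) = p + r := by
  rw [modF, LinearMap.finrank_range_of_inj]
  · simp
  · exact LinearMap.inl_injective.prodMap LinearMap.inl_injective

lemma modF_inf_modX : modF p q r s ⊓ modX p q r s =
    LinearMap.range (LinearMap.inl ℂ (Vec p × Vec q) (Vec r × Vec s) ∘ₗ LinearMap.inl ℂ _ _) := by
  ext x
  rw [Submodule.mem_inf, mem_modF, mem_modX]
  constructor
  · rintro ⟨⟨h1, -⟩, h2⟩
    exact ⟨x.1.1, Prod.ext (Prod.ext rfl h1.symm) h2.symm⟩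
  · rintro ⟨y, rfl⟩
    simp

lemma inl_inl_injective : Function.Injective
    (LinearMap.inl ℂ (Vec p × Vec q) (Vec r × Vec s) ∘ₗ LinearMap.inl ℂ (Vec p) (Vec q)) :=
  LinearMap.inl_injective.comp LinearMap.inl_injective

lemma finrank_modF_inf_modX : finrank ℂ (modF p q r s ⊓ modX p q r s : Submodule ℂ (Mod p q r s)) = p := by
  rw [modF_inf_modX, LinearMap.finrank_range_of_inj inl_inl_injective, finrank_fin_fun]

variable (a : Vec q →ₗ[ℂ] Vec p) (b : Vec s →ₗ[ℂ] Vec p) (c : Vec s →ₗ[ℂ] Vec r)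

lemma map_blk_modX : (modX p q r s).map (blk a b c) =
    (LinearMap.range a).map (LinearMap.inl ℂ (Vec p × Vec q) (Vec r × Vec s) ∘ₗ
      LinearMap.inl ℂ _ _) := by
  ext x
  constructor
  · rintro ⟨y, hy, rfl⟩
    have hy := mem_modX.1 hy
    exact ⟨a y.1.2, ⟨_, rfl⟩, by simp [blk_apply, hy, Prod.ext_iff]⟩
  · rintro ⟨_, ⟨y, rfl⟩, rfl⟩
    exact ⟨((0, y), 0), mem_modX.2 rfl, by simp [blk_apply]⟩

/-- The third coordinate maps the image of the operator onto the image of `c`, and its kernel on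
that image is the intersection with `modX`. -/
lemma finrank_range_blk : finrank ℂ (LinearMap.range (blk a b c)) = finrank ℂ (LinearMap.range c) +
    finrank ℂ (LinearMap.range (blk a b c) ⊓ modX p q r s : Submodule ℂ (Mod p q r s)) := by
  have h1 : (LinearMap.range (blk a b c)).map (LinearMap.fst ℂ (Vec r) (Vec s) ∘ₗ
      LinearMap.snd ℂ (Vec p × Vec q) _) = LinearMap.range c := by
    ext x
    constructor
    · rintro ⟨_, ⟨y, rfl⟩, rfl⟩
      exact ⟨y.2.2, by simp [blk_apply]⟩
    · rintro ⟨y, rfl⟩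
      exact ⟨_, ⟨((0, 0), (0, y)), rfl⟩, by simp [blk_apply]⟩
  have h2 : LinearMap.ker (LinearMap.fst ℂ (Vec r) (Vec s) ∘ₗ LinearMap.snd ℂ (Vec p × Vec q) _) ⊓
      LinearMap.range (blk a b c) = LinearMap.range (blk a b c) ⊓ modX p q r s := by
    rw [inf_comm]
    ext x
    simp only [Submodule.mem_inf, and_congr_right_iff]
    rintro ⟨y, rfl⟩
    rw [mem_modX]
    simp [blk_apply, Prod.ext_iff]
  rw [← finrank_map_add_finrank_inf_ker (LinearMap.fst ℂ (Vec r) (Vec s) ∘ₗ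
    LinearMap.snd ℂ (Vec p × Vec q) _) (LinearMap.range (blk a b c)), h1, h2]

/-- The point given by an isomorphism with the standard space and an operator on it. -/
def modelTriple {n : ℕ} (e : Mod p q r s ≃ₗ[ℂ] Vec n) (τ : End ℂ (Mod p q r s)) : Triple n :=
  ⟨e.conj τ, (modX p q r s).map (e : _ →ₗ[ℂ] Vec n), (modF p q r s).map (e : _ →ₗ[ℂ] Vec n)⟩

variable {n : ℕ} (e : Mod p q r s ≃ₗ[ℂ] Vec n) (τ : End ℂ (Mod p q r s))

lemma map_conj (X : Submodule ℂ (Mod p q r s)) :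
    (X.map (e : _ →ₗ[ℂ] Vec n)).map (e.conj τ) = (X.map τ).map (e : _ →ₗ[ℂ] Vec n) := by
  rw [← Submodule.map_comp, ← Submodule.map_comp]
  congr 1
  refine LinearMap.ext fun x => ?_
  simp [LinearEquiv.conj_apply]

lemma range_conj : LinearMap.range (e.conj τ) = (LinearMap.range τ).map (e : _ →ₗ[ℂ] Vec n) := by
  rw [LinearMap.range_eq_map τ, ← map_conj, Submodule.map_top, e.range, Submodule.map_top]

lemma compatible_conj_blk : Compatible (p + q) (finrank ℂ (LinearMap.range a))
    (finrank ℂ (LinearMap.range c)) (e.conj (blk a b c))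
    ((modX p q r s).map (e : _ →ₗ[ℂ] Vec n)) := by
  have h1 := map_conj e (blk a b c) (modX p q r s)
  have h2 : LinearMap.range (e.conj (blk a b c)) ⊓ (modX p q r s).map (e : _ →ₗ[ℂ] Vec n) =
      (LinearMap.range (blk a b c) ⊓ modX p q r s).map (e : _ →ₗ[ℂ] Vec n) := by
    rw [range_conj, Submodule.map_inf _ e.injective]
  rw [compatible_iff, h1, h2, range_conj]
  refine ⟨by rw [LinearEquiv.finrank_map_eq, finrank_modX], Submodule.map_mono ?_, ?_, ?_⟩
  · rintro _ ⟨x, hx, rfl⟩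
    have := mem_modX.1 hx
    simp [mem_modX, blk_apply, this]
  · rw [LinearEquiv.finrank_map_eq, map_blk_modX, finrank_map_of_injective inl_inl_injective]
  · rw [LinearEquiv.finrank_map_eq, LinearEquiv.finrank_map_eq]
    exact finrank_range_blk a b c

lemma mem_M2tot_conj_blk :
    (e.conj (blk a b c), (modF p q r s).map (e : _ →ₗ[ℂ] Vec n)) ∈ M2tot n := by
  refine ⟨LinearMap.ext fun x => ?_, ?_, ?_⟩
  · simp [LinearEquiv.conj_apply, blk_apply]
  · change LinearMap.range (e.conj _) ≤ (modF p q r s).map _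
    rw [range_conj]
    refine Submodule.map_mono ?_
    rintro _ ⟨x, rfl⟩
    simp [mem_modF, blk_apply]
  · rintro _ ⟨x, hx, rfl⟩
    have := mem_modF.1 hx
    simp [LinearEquiv.conj_apply, blk_apply, this]

lemma finrank_map_modF_inf_map_modX : finrank ℂ ((modF p q r s).map (e : _ →ₗ[ℂ] Vec n) ⊓
    (modX p q r s).map (e : _ →ₗ[ℂ] Vec n) : Gr n) = p := by
  rw [← Submodule.map_inf _ e.injective, LinearEquiv.finrank_map_eq, finrank_modF_inf_modX]

lemma finrank_map_modF : finrank ℂ ((modF p q r s).map (e : _ →ₗ[ℂ] Vec n)) = p + r := by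
  rw [LinearEquiv.finrank_map_eq, finrank_modF]

lemma modelTriple_blk_mem (e : Mod p q r s ≃ₗ[ℂ] Vec (p + q + (r + s))) :
    modelTriple e (blk a b c) ∈ T2vv p (p + q) (finrank ℂ (LinearMap.range a)) r (r + s)
      (finrank ℂ (LinearMap.range c)) :=
  mem_T2vv_iff.2 ⟨⟨mem_M2tot_conj_blk a b c e, compatible_conj_blk a b c e⟩,
    finrank_map_modF_inf_map_modX e, finrank_map_modF e⟩

/-- The operator kills `modF`, has image in `modF` and preserves `modX`; these three conditions
annihilate every block except `a`, `b` and `c`. -/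
lemma exists_blk_of_modelTriple_mem {e : Mod p q r s ≃ₗ[ℂ] Vec (p + q + (r + s))}
    {τ : End ℂ (Mod p q r s)} {r1 r2 : ℕ}
    (h : modelTriple e τ ∈ T2 (p + q) r1 (r + s) r2) :
    ∃ a b c, τ = blk a b c ∧ finrank ℂ (LinearMap.range a) = r1 ∧
      finrank ℂ (LinearMap.range c) = r2 := by
  obtain ⟨⟨-, h1, h2⟩, h3⟩ := id h
  have hF : ∀ x ∈ modF p q r s, τ x = 0 := fun x hx => by
    have := h2 ⟨x, hx, rfl⟩
    simpa [modelTriple, LinearEquiv.conj_apply] using this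
  have hT : ∀ x, τ x ∈ modF p q r s := fun x => by
    have := h1 ⟨e x, rfl⟩
    simpa [modelTriple, LinearEquiv.conj_apply] using this
  have hX : ∀ x ∈ modX p q r s, τ x ∈ modX p q r s := fun x hx => by
    have h4 := (compatible_iff.1 h3).2.1
    have := h4 ⟨_, ⟨x, hx, rfl⟩, rfl⟩
    simpa [modelTriple, LinearEquiv.conj_apply] using this
  let a : Vec q →ₗ[ℂ] Vec p := LinearMap.fst ℂ _ _ ∘ₗ LinearMap.fst ℂ _ _ ∘ₗ τ ∘ₗ
    LinearMap.inl ℂ _ _ ∘ₗ LinearMap.inr ℂ _ _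
  let b : Vec s →ₗ[ℂ] Vec p := LinearMap.fst ℂ _ _ ∘ₗ LinearMap.fst ℂ _ _ ∘ₗ τ ∘ₗ
    LinearMap.inr ℂ _ _ ∘ₗ LinearMap.inr ℂ _ _
  let c : Vec s →ₗ[ℂ] Vec r := LinearMap.fst ℂ _ _ ∘ₗ LinearMap.snd ℂ _ _ ∘ₗ τ ∘ₗ
    LinearMap.inr ℂ _ _ ∘ₗ LinearMap.inr ℂ _ _
  have hτ : τ = blk a b c := by
    refine LinearMap.ext fun x => ?_
    have hx : x = ((x.1.1, 0), (x.2.1, 0)) + (((0, x.1.2), (0, 0)) + ((0, 0), (0, x.2.2))) := by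
      ext <;> simp
    have e1 := hF ((x.1.1, 0), (x.2.1, 0)) (mem_modF.2 ⟨rfl, rfl⟩)
    have e2 := mem_modX.1 (hX ((0, x.1.2), (0, 0)) (mem_modX.2 rfl))
    have e3 := mem_modF.1 (hT ((0, x.1.2), (0, 0)))
    have e4 := mem_modF.1 (hT ((0, 0), (0, x.2.2)))
    have e5 : τ x = τ ((0, x.1.2), (0, 0)) + τ ((0, 0), (0, x.2.2)) := by
      conv_lhs => rw [hx, map_add, map_add, e1, zero_add]
    rw [e5, blk_apply]
    refine Prod.ext (Prod.ext rfl ?_) (Prod.ext ?_ ?_)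
    · simp [e3.1, e4.1]
    · change (τ ((0, x.1.2), (0, 0))).2.1 + _ = _
      rw [e2]
      exact zero_add _
    · simp [e3.2, e4.2]
  clear_value a b c
  subst hτ
  have h5 := compatible_iff.1 (modelTriple_blk_mem a b c e).1.2
  have h6 := compatible_iff.1 h3
  refine ⟨a, b, c, rfl, h5.2.2.1.symm.trans h6.2.2.1, ?_⟩
  omega

lemma exists_blk_rank {r1 r2 : ℕ} (hp : r1 ≤ p) (hq : r1 ≤ q) (hr : r2 ≤ r) (hs : r2 ≤ s) :
    ∃ (a : Vec q →ₗ[ℂ] Vec p) (b : Vec s →ₗ[ℂ] Vec p) (c : Vec s →ₗ[ℂ] Vec r),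
      finrank ℂ (LinearMap.range a) = r1 ∧ finrank ℂ (LinearMap.range c) = r2 ∧
      min (p + r2) (s + r1) ≤ finrank ℂ (LinearMap.range (blk a b c)) := by
  obtain ⟨a, ha⟩ := exists_finrank_range_eq (k := r1) (V := Vec q) (V' := Vec p)
    (by simpa) (by simpa)
  obtain ⟨c, hc⟩ := exists_finrank_range_eq (k := r2) (V := Vec s) (V' := Vec r)
    (by simpa) (by simpa)
  obtain ⟨P, hP⟩ := exists_isCompl (LinearMap.range a)
  have h1 := Submodule.finrank_add_eq_of_isCompl hP
  have h2 := c.finrank_range_add_finrank_ker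
  rw [finrank_fin_fun] at h1 h2
  -- The free block is taken of maximal rank from `ker c` to a complement of `im a`, so its
  -- contribution adds to those of `a` and `c`: `r1 + r2 + min (p - r1) (s - r2)` is the required
  -- bound.
  obtain ⟨β, hβ⟩ := exists_finrank_range_eq (k := min (p - r1) (s - r2))
    (V := LinearMap.ker c) (V' := P) (by omega) (by omega)
  obtain ⟨b, hb⟩ := (P.subtype ∘ₗ β).exists_extend
  refine ⟨a, b, c, ha, hc, ?_⟩
  have h3 : Disjoint (LinearMap.range a) ((LinearMap.range β).map P.subtype) :=
    hP.disjoint.mono_right (Submodule.map_subtype_le _ _)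
  have h4 := finrank_sup_of_disjoint h3
  rw [finrank_map_of_injective P.injective_subtype] at h4
  have h5 : (LinearMap.range a ⊔ (LinearMap.range β).map P.subtype).map
      (LinearMap.inl ℂ (Vec p × Vec q) (Vec r × Vec s) ∘ₗ LinearMap.inl ℂ _ _) ≤
      (LinearMap.range (blk a b c) ⊓ modX p q r s : Submodule ℂ (Mod p q r s)) := by
    rw [Submodule.map_sup, sup_le_iff]
    constructor
    · rintro _ ⟨_, ⟨y, rfl⟩, rfl⟩
      exact ⟨⟨((0, y), (0, 0)), by simp [blk_apply]⟩, mem_modX.2 rfl⟩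
    · rintro _ ⟨_, ⟨_, ⟨y, rfl⟩, rfl⟩, rfl⟩
      have h6 : b y = β y := LinearMap.congr_fun hb y
      exact ⟨⟨((0, 0), (0, y)), by simp [blk_apply, h6]⟩, mem_modX.2 rfl⟩
  have h6 := Submodule.finrank_mono h5
  rw [finrank_map_of_injective inl_inl_injective] at h6
  have h7 := finrank_range_blk a b c
  rw [hc] at h7
  refine le_trans ?_ h7.ge
  refine le_trans ?_ (Nat.add_le_add_left h6 r2)
  rw [h4, ha, hβ]
  omega

end Model

/-! ### The two stratifications of the tensor product variety and their closures. -/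

section Strata

lemma map_symm_map_equiv {n : ℕ} (Ψ : Vec n ≃ₗ[ℂ] Vec n) (X : Gr n) :
    (X.map (Ψ : Vec n →ₗ[ℂ] Vec n)).map (Ψ.symm : Vec n →ₗ[ℂ] Vec n) = X := by
  rw [← Submodule.map_comp]
  convert Submodule.map_id X
  ext
  simp

/-- The parameters are an invertible `g`, full-rank factors of the two diagonal blocks, and the free
block. No separate scalar is needed, since the block operators of given ranks are stable under
nonzero scaling. -/
lemma isPreirreducible_T2vv_add (p q r s r1 r2 : ℕ) :
    IsPreirreducible (T2vv p (p + q) r1 r (r + s) r2) := by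
  let n := p + q + (r + s)
  let e : Mod p q r s ≃ₗ[ℂ] Vec n := LinearEquiv.ofFinrankEq _ _ (by simp [n])
  let X := (modX p q r s).map (e : _ →ₗ[ℂ] Vec n)
  let F := (modF p q r s).map (e : _ →ₗ[ℂ] Vec n)
  let W := End ℂ (Vec n) × ((Vec r1 →ₗ[ℂ] Vec p) × (Vec q →ₗ[ℂ] Vec r1)) ×
    ((Vec r2 →ₗ[ℂ] Vec r) × (Vec s →ₗ[ℂ] Vec r2)) × (Vec s →ₗ[ℂ] Vec p)
  have p1 : IsPolyMap fun x : W => x.1 := isPolyMap_fst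
  have p2 : IsPolyMap fun x : W => x.2.1.1 :=
    isPolyMap_fst.comp (isPolyMap_fst.comp isPolyMap_snd)
  have p3 : IsPolyMap fun x : W => x.2.1.2 :=
    isPolyMap_snd.comp (isPolyMap_fst.comp isPolyMap_snd)
  have p4 : IsPolyMap fun x : W => x.2.2.1.1 :=
    isPolyMap_fst.comp (isPolyMap_fst.comp (isPolyMap_snd.comp isPolyMap_snd))
  have p5 : IsPolyMap fun x : W => x.2.2.1.2 :=
    isPolyMap_snd.comp (isPolyMap_fst.comp (isPolyMap_snd.comp isPolyMap_snd))
  have p6 : IsPolyMap fun x : W => x.2.2.2 :=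
    isPolyMap_snd.comp (isPolyMap_snd.comp isPolyMap_snd)
  let T : W → End ℂ (Vec n) := fun x =>
    e.conj (blk (x.2.1.1 ∘ₗ x.2.1.2) x.2.2.2 (x.2.2.1.1 ∘ₗ x.2.2.1.2))
  have pT : IsPolyMap T := (isPolyMap_linear e.conj.toLinearMap).comp
    (IsPolyMap.blk (p2.linComp p3) p6 (p4.linComp p5))
  have q1 : IsPolyMap fun x : W => x.1 ∘ₗ T x ∘ₗ adj x.1 := p1.linComp (pT.linComp p1.adj)
  have q2 : IsPolyMap fun (x : W) i => x.1 (basisFamily X i) :=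
    IsPolyMap.pi fun i => p1.apply (basisFamily X i)
  have q3 : IsPolyMap fun (x : W) i => x.1 (basisFamily F i) :=
    IsPolyMap.pi fun i => p1.apply (basisFamily F i)
  have hU := @IsOpen.inter _ (zariski W) _ _ (isOpen_ne_zero p1.det)
    (@IsOpen.inter _ (zariski W) _ _ (@IsOpen.inter _ (zariski W) _ _
      (isOpen_le_finrank_range r1 p2) (isOpen_le_finrank_range r1 p3))
      (@IsOpen.inter _ (zariski W) _ _
        (isOpen_le_finrank_range r2 p4) (isOpen_le_finrank_range r2 p5)))
  have := isPreirreducible_triple_image hU q1 q2 q3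
    (fun x hx => linearIndependent_map_basisFamily X hx.1)
    (fun x hx => linearIndependent_map_basisFamily F hx.1)
  simp only [span_map_basisFamily] at this
  convert this
  ext ⟨t', X', F'⟩
  constructor
  · intro hx
    obtain ⟨hT, hv1, hv2⟩ := mem_T2vv_iff.1 hx
    obtain ⟨Ψ, -, hX, hF⟩ := exists_equiv_config (V := Vec n) (V' := Vec n) rfl (Z := ⊥) (Z' := ⊥)
      (T := X) (T' := X') (Y := F) (Y' := F') bot_le bot_le (by simp)
      (by rw [LinearEquiv.finrank_map_eq, finrank_modX]; exact hT.2.1.symm)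
      (by rw [finrank_map_modF]; exact hv2.symm)
      (by rw [inf_comm, finrank_map_modF_inf_map_modX, inf_comm]; exact hv1.symm)
    have hd := det_coe_ne_zero Ψ
    set d := LinearMap.det (Ψ : End ℂ (Vec n)) with hd'
    -- The factor `d⁻¹` is chosen so that conjugating `τ` by `Ψ` and its adjugate returns `t'`
    -- exactly.
    let τ : End ℂ (Vec n) := d⁻¹ • Ψ.symm.conj t'
    have h1 : ∀ x, Ψ.symm (t' x) = d • τ (Ψ.symm x) := fun x => by
      simp [τ, LinearEquiv.conj_apply, smul_smul, mul_inv_cancel₀ hd]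
    have h2 : ∀ x, Ψ (τ x) = d⁻¹ • t' (Ψ x) := fun x => by
      simp [τ, LinearEquiv.conj_apply]
    have h3 := mem_T2_of_conj hT hd h1
    have hX' := map_symm_map_equiv Ψ X
    have hF' := map_symm_map_equiv Ψ F
    rw [hX] at hX'
    rw [hF] at hF'
    rw [hX', hF'] at h3
    obtain ⟨a, b, c, h4, h5, h6⟩ := exists_blk_of_modelTriple_mem (e := e) (τ := e.symm.conj τ)
      (r1 := r1) (r2 := r2) (by
        convert h3 using 1
        ext1
        · refine LinearMap.ext fun x => ?_
          simp [modelTriple, LinearEquiv.conj_apply]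
        · rfl
        · rfl)
    obtain ⟨M, N, rfl, hM, hN⟩ := exists_comp_of_finrank_range h5
    obtain ⟨M', N', rfl, hM', hN'⟩ := exists_comp_of_finrank_range h6
    refine ⟨(Ψ, (M, N), (M', N'), b), ⟨hd, ⟨hM, hN⟩, hM', hN'⟩, ?_⟩
    have h7 : T (Ψ, (M, N), (M', N'), b) = τ := by
      change e.conj (blk (M ∘ₗ N) b (M' ∘ₗ N')) = τ
      rw [← h4]
      refine LinearMap.ext fun x => ?_
      simp [LinearEquiv.conj_apply]
    ext1
    · change (Ψ : End ℂ (Vec n)) ∘ₗ T (Ψ, (M, N), (M', N'), b) ∘ₗ adj (Ψ : End ℂ (Vec n)) = t'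
      rw [h7, eq_conj_adj h2 (inv_ne_zero hd), ← hd', inv_mul_cancel₀ hd, inv_one, one_smul]
    · exact hX
    · exact hF
  · rintro ⟨x, ⟨hg, ⟨hM, hN⟩, hM', hN'⟩, hx⟩
    have h1 := modelTriple_blk_mem (x.2.1.1 ∘ₗ x.2.1.2) x.2.2.2 (x.2.2.1.1 ∘ₗ x.2.2.1.2) e
    rw [finrank_range_comp_of_le hM hN, finrank_range_comp_of_le hM' hN'] at h1
    rw [← hx]
    refine mem_T2vv_of_conj (Ψ := autOfDet x.1 hg) h1 (inv_ne_zero hg) fun y => ?_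
    change x.1 (T x y) = _ • (x.1 ∘ₗ T x ∘ₗ adj x.1) (x.1 y)
    rw [conj_adj, smul_smul, inv_mul_cancel₀ hg, one_smul]

variable {v1 w1 r1 v2 w2 r2 : ℕ}

lemma isPreirreducible_T2vv (h1 : v1 ≤ w1) (h2 : v2 ≤ w2) :
    IsPreirreducible (T2vv v1 w1 r1 v2 w2 r2) := by
  obtain ⟨q, rfl⟩ := Nat.exists_eq_add_of_le h1
  obtain ⟨s, rfl⟩ := Nat.exists_eq_add_of_le h2
  exact isPreirreducible_T2vv_add _ _ _ _ _ _

/-- The values of `(v¹, v²)` for which the stratum is nonempty. -/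
def Admissible (w1 r1 w2 r2 : ℕ) (v : ℕ × ℕ) : Prop :=
  r1 ≤ v.1 ∧ v.1 + r1 ≤ w1 ∧ r2 ≤ v.2 ∧ v.2 + r2 ≤ w2

/-- The rank of `t` at a general point of the stratum given by `(v¹, v²)`. -/
def genericRank (r1 w2 r2 : ℕ) (v : ℕ × ℕ) : ℕ := min (w2 + r1 - v.2) (v.1 + r2)

lemma admissible_of_mem_T2vv {x : Triple (w1 + w2)} (hx : x ∈ T2vv v1 w1 r1 v2 w2 r2) :
    Admissible w1 r1 w2 r2 (v1, v2) ∧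
      finrank ℂ (LinearMap.range x.t) ≤ genericRank r1 w2 r2 (v1, v2) := by
  obtain ⟨h1, h2, h3⟩ := mem_T2vv_iff.1 hx
  have h4 := invariants_le (t := x.t) (F := x.F) rfl h1.1.2.1 h1.1.2.2 h1.2
  simp only [Admissible, genericRank]
  rw [h2, h3] at h4
  omega

lemma exists_mem_T2vv_inter_T2vr {v : ℕ × ℕ} (h : Admissible w1 r1 w2 r2 v) :
    (T2vv v.1 w1 r1 v.2 w2 r2 ∩
      T2vr (v.1 + v.2) w1 r1 w2 r2 (genericRank r1 w2 r2 v)).Nonempty := by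
  obtain ⟨v1, v2⟩ := v
  obtain ⟨h1, h2, h3, h4⟩ := h
  simp only at h1 h2 h3 h4
  obtain ⟨q, rfl⟩ := Nat.exists_eq_add_of_le (show v1 ≤ w1 by omega)
  obtain ⟨s, rfl⟩ := Nat.exists_eq_add_of_le (show v2 ≤ w2 by omega)
  obtain ⟨a, b, c, rfl, rfl, hr⟩ := exists_blk_rank (p := v1) (q := q) (r := v2) (s := s) h1
    (by omega) h3 (by omega)
  let e : Mod v1 q v2 s ≃ₗ[ℂ] Vec (v1 + q + (v2 + s)) := LinearEquiv.ofFinrankEq _ _ (by simp)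
  have h5 := modelTriple_blk_mem a b c e
  have h6 := (admissible_of_mem_T2vv h5).2
  refine ⟨_, h5, h5.1, (mem_T2vv_iff.1 h5).2.2, h5.1.1.1, le_antisymm h6 ?_⟩
  change _ ≤ finrank ℂ (LinearMap.range (e.conj (blk a b c)))
  rw [range_conj, LinearEquiv.finrank_map_eq]
  refine le_trans ?_ hr
  simp only [genericRank]
  omega

lemma exists_admissible_of_T2vr_nonempty {v r : ℕ} (h : (T2vr v w1 r1 w2 r2 r).Nonempty) :
    ∃ p, Admissible w1 r1 w2 r2 p ∧ p.1 + p.2 = v ∧ genericRank r1 w2 r2 p = r := by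
  obtain ⟨x, h1, h2, h3⟩ := h
  have h4 := invariants_le (t := x.t) (F := x.F) rfl h1.1.2.1 h1.1.2.2 h1.2
  have h5 := x.t.finrank_range_add_finrank_ker
  have h6 := Submodule.finrank_mono h1.1.2.1
  have h7 := Submodule.finrank_mono h1.1.2.2
  simp only at h6 h7
  rw [h3.2, finrank_fin_fun] at h5
  rw [h3.2] at h6
  rw [h2] at h6 h7
  rw [h2, h3.2] at h4
  -- For fixed `v = v¹ + v²` the generic rank is `v¹ + min (w2 + r1 - v) r2`, read over the
  -- integers; setting this equal to `r` and solving for `v¹` gives the witness.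
  refine ⟨(max (r + v - (w2 + r1)) (r - r2), v - max (r + v - (w2 + r1)) (r - r2)), ?_, ?_, ?_⟩
  all_goals
    simp only [Admissible, genericRank]
    omega

/-- With the sum fixed, the generic rank is strictly increasing in the first entry, so the two
inequalities pull in opposite directions. -/
lemma admissible_eq_of_le {p p' : ℕ × ℕ} (h : Admissible w1 r1 w2 r2 p)
    (h' : Admissible w1 r1 w2 r2 p') (hs : p.1 + p.2 = p'.1 + p'.2) (h1 : p'.1 ≤ p.1)
    (h2 : genericRank r1 w2 r2 p ≤ genericRank r1 w2 r2 p') : p = p' := by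
  simp only [Admissible, genericRank] at h h' h2
  ext <;> omega

/-- The closures of the strata for the two stratifications agree. -/
lemma closure_T2vv_eq {v : ℕ × ℕ} (h : Admissible w1 r1 w2 r2 v) :
    closure (T2vv v.1 w1 r1 v.2 w2 r2) =
      closure (T2vr (v.1 + v.2) w1 r1 w2 r2 (genericRank r1 w2 r2 v)) := by
  set A := T2vv v.1 w1 r1 v.2 w2 r2
  set B := T2vr (v.1 + v.2) w1 r1 w2 r2 (genericRank r1 w2 r2 v)
  have hne : (A ∩ B).Nonempty := exists_mem_T2vv_inter_T2vr h
  -- The generic rank is the maximum on `A`, so the open condition of having at least this rank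
  -- forces equality.
  have hA : A ∩ {x | genericRank r1 w2 r2 v ≤ finrank ℂ (LinearMap.range x.t)} ⊆ A ∩ B := by
    rintro x ⟨hx, hx'⟩
    have h1 := mem_T2vv_iff.1 hx
    exact ⟨hx, h1.1, h1.2.2, h1.1.1.1, le_antisymm (admissible_of_mem_T2vv hx).2 hx'⟩
  -- On `B` the inequalities bound `dim (F ∩ X)` below by `v.1`, so this open condition selects the
  -- points of `A`.
  have hB : B ∩ {x | finrank ℂ (x.F ⊓ x.X : Gr (w1 + w2)) ≤ v.1} ⊆ A ∩ B := by
    rintro x ⟨hx, hx'⟩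
    obtain ⟨h1, h2, h3⟩ := id hx
    refine ⟨mem_T2vv_iff.2 ⟨h1, ?_, h2⟩, hx⟩
    have h4 := invariants_le (t := x.t) (F := x.F) rfl h1.1.2.1 h1.1.2.2 h1.2
    rw [h2, h3.2] at h4
    simp only [Admissible, genericRank, Set.mem_ofPred_eq] at h h4 hx'
    omega
  obtain ⟨x, hxA, hxB⟩ := hne
  have hiA : IsPreirreducible A := isPreirreducible_T2vv (by have := h.2.1; omega)
    (by have := h.2.2.2; omega)
  have hiB : IsPreirreducible B := isPreirreducible_T2vr _ _ _ _ _ _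
  apply Set.Subset.antisymm
  · refine closure_minimal ?_ isClosed_closure
    have := subset_closure_inter_of_isPreirreducible_of_isOpen hiA
      (isOpen_triple_le_rank (genericRank r1 w2 r2 v)) ⟨x, hxA, hxB.2.2.2.ge⟩
    exact this.trans (closure_mono (hA.trans Set.inter_subset_right))
  · refine closure_minimal ?_ isClosed_closure
    have := subset_closure_inter_of_isPreirreducible_of_isOpen hiB
      (isOpen_triple_finrank_inf_le v.1) ⟨x, hxB, (mem_T2vv_iff.1 hxA).2.1.le⟩
    exact this.trans (closure_mono (hB.trans Set.inter_subset_left))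

lemma eq_of_T2vv_subset_closure {v v' : ℕ × ℕ} (h : Admissible w1 r1 w2 r2 v)
    (h' : Admissible w1 r1 w2 r2 v')
    (hsub : T2vv v.1 w1 r1 v.2 w2 r2 ⊆ closure (T2vv v'.1 w1 r1 v'.2 w2 r2)) : v = v' := by
  obtain ⟨x, hxA, hxB⟩ := exists_mem_T2vv_inter_T2vr h
  have hx := hsub hxA
  obtain ⟨-, h1, h2⟩ := mem_T2vv_iff.1 hxA
  -- A generic point of the first stratum is a limit of the second; each of the three open
  -- conditions it satisfies must therefore hold somewhere on the second stratum.
  obtain ⟨y, hy, hy'⟩ := mem_closure_iff.1 hx _ (isOpen_triple_finrank (· = v.1 + v.2)) h2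
  obtain ⟨z, hz, hz'⟩ := mem_closure_iff.1 hx _ (isOpen_triple_finrank_inf_le v.1) h1.le
  obtain ⟨u, hu, hu'⟩ := mem_closure_iff.1 hx _
    (isOpen_triple_le_rank (genericRank r1 w2 r2 v)) hxB.2.2.2.ge
  refine admissible_eq_of_le h h' ?_ ?_ (le_trans hu (admissible_of_mem_T2vv hu').2)
  · exact hy.symm.trans (mem_T2vv_iff.1 hy').2.2
  · exact (mem_T2vv_iff.1 hz').2.1.symm.le.trans hz

end Strata

/-! ### Irreducible components from a finite decomposition. -/

section Components

lemma isIrreducible_image_val_iff {α : Type} [TopologicalSpace α] {S : Set α} {C : Set S} :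
    IsIrreducible (Subtype.val '' C) ↔ IsIrreducible C := by
  refine ⟨fun h => ⟨Set.image_nonempty.1 h.1, ?_⟩, fun h => h.image _ continuous_subtype_val.continuousOn⟩
  rintro u v hu hv ⟨x, hx, hxu⟩ ⟨y, hy, hyv⟩
  obtain ⟨u', hu', rfl⟩ := isOpen_induced_iff.1 hu
  obtain ⟨v', hv', rfl⟩ := isOpen_induced_iff.1 hv
  obtain ⟨_, ⟨z, hz, rfl⟩, hzu, hzv⟩ := h.2 u' v' hu' hv' ⟨x, ⟨x, hx, rfl⟩, hxu⟩
    ⟨y, ⟨y, hy, rfl⟩, hyv⟩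
  exact ⟨z, hz, hzu, hzv⟩

lemma mem_components_iff {α : Type} [TopologicalSpace α] {S C : Set α} :
    C ∈ components S ↔ Maximal (fun Z => Z ⊆ S ∧ IsIrreducible Z) C := by
  constructor
  · rintro ⟨C, hC, rfl⟩
    refine ⟨⟨Subtype.coe_image_subset _ _, isIrreducible_image_val_iff.2 hC.1⟩, ?_⟩
    rintro Z ⟨hZ, hZ'⟩ hCZ
    have e : Subtype.val '' (Subtype.val ⁻¹' Z : Set S) = Z := by
      rw [Subtype.image_preimage_coe, Set.inter_eq_right.2 hZ]
    rw [← e] at hZ' ⊢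
    exact Set.image_mono (hC.2 (isIrreducible_image_val_iff.1 hZ')
      (Set.image_subset_iff.1 hCZ))
  · rintro ⟨⟨hCS, hC⟩, hmax⟩
    have e : Subtype.val '' (Subtype.val ⁻¹' C : Set S) = C := by
      rw [Subtype.image_preimage_coe, Set.inter_eq_right.2 hCS]
    refine ⟨Subtype.val ⁻¹' C, ⟨isIrreducible_image_val_iff.1 (e.symm ▸ hC), ?_⟩, e⟩
    intro Z hZ hCZ
    have := hmax ⟨Subtype.coe_image_subset _ _, isIrreducible_image_val_iff.2 hZ⟩
      (e.symm.subset.trans (Set.image_mono hCZ))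
    exact Set.image_subset_iff.1 this

lemma components_eq_range {α ι : Type} [TopologicalSpace α] [Finite ι] {S : Set α} {A : ι → Set α}
    (hS : S = ⋃ i, A i) (hA : ∀ i, IsIrreducible (A i))
    (hne : ∀ i j, A i ⊆ closure (A j) → i = j) :
    components S = Set.range fun i => closure (A i) ∩ S := by
  have hAS : ∀ i, A i ⊆ S := fun i => hS ▸ Set.subset_iUnion A i
  have hirr : ∀ i, IsIrreducible (closure (A i) ∩ S) := fun i => by
    refine ⟨(hA i).1.mono (Set.subset_inter subset_closure (hAS i)), ?_⟩
    rintro u v hu hv ⟨x, ⟨hx, -⟩, hxu⟩ ⟨y, ⟨hy, -⟩, hyv⟩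
    obtain ⟨x', hx', hx''⟩ := mem_closure_iff.1 hx u hu hxu
    obtain ⟨y', hy', hy''⟩ := mem_closure_iff.1 hy v hv hyv
    obtain ⟨z, hz, hz'⟩ := (hA i).2 u v hu hv ⟨x', hx'', hx'⟩ ⟨y', hy'', hy'⟩
    exact ⟨z, ⟨subset_closure hz, hAS i hz⟩, hz'⟩
  -- An irreducible set covered by finitely many closed sets lies in one of them.
  have hcov : ∀ Z, Z ⊆ S → IsIrreducible Z → ∃ i, Z ⊆ closure (A i) := by
    intro Z hZ hZ'
    have hfin := Set.finite_range fun i => closure (A i)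
    obtain ⟨z, hz, hz'⟩ := isIrreducible_iff_sUnion_isClosed.1 hZ' hfin.toFinset
      (by simp) (by
        rw [hfin.coe_toFinset, Set.sUnion_range]
        exact hZ.trans (hS.subset.trans (Set.iUnion_mono fun i => subset_closure)))
    obtain ⟨i, rfl⟩ := hfin.mem_toFinset.1 hz
    exact ⟨i, hz'⟩
  ext C
  rw [mem_components_iff]
  constructor
  · rintro ⟨⟨h1, h2⟩, h3⟩
    obtain ⟨i, hi⟩ := hcov C h1 h2
    have h4 : C ⊆ closure (A i) ∩ S := Set.subset_inter hi h1
    exact ⟨i, Set.Subset.antisymm (h3 ⟨Set.inter_subset_right, hirr i⟩ h4) h4⟩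
  · rintro ⟨i, rfl⟩
    refine ⟨⟨Set.inter_subset_right, hirr i⟩, fun Z hZ hiZ => ?_⟩
    obtain ⟨j, hj⟩ := hcov Z hZ.1 hZ.2
    have := hne i j ((Set.subset_inter subset_closure (hAS i)).trans (hiZ.trans hj))
    subst this
    exact Set.subset_inter hj hZ.1

end Components

/-! ### Crystals that are disjoint unions of strings. -/

section Strings

namespace Crystal

variable {A B : Type}

/-- A crystal that is a disjoint union of strings: an element is determined by the label `ρ` of its
string and its position `d`, and for a given label `ρ` the positions are those with
`ρ ≤ d ≤ w - ρ`. -/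
structure IsStrings (K : Crystal A) (w : ℕ) (ρ d : A → ℕ) : Prop where
  inj : ∀ a b, ρ a = ρ b → d a = d b → a = b
  le_d : ∀ a, ρ a ≤ d a
  d_le : ∀ a, d a + ρ a ≤ w
  exists_eq : ∀ a k, ρ a ≤ k → k + ρ a ≤ w → ∃ b, ρ b = ρ a ∧ d b = k
  wt : ∀ a, K.wt a = ((d a : ℤ), (w : ℤ) - d a)
  ε : ∀ a, K.ε a = (w : ℤ) - ρ a - d a
  φ : ∀ a, K.φ a = (d a : ℤ) - ρ a
  e : ∀ a b, K.e a = some b ↔ ρ b = ρ a ∧ d b = d a + 1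
  f : ∀ a b, K.f a = some b ↔ ρ b = ρ a ∧ d b + 1 = d a

variable {K : Crystal A} {w : ℕ} {ρ d : A → ℕ}

lemma iter_succ_eq_some {g : A → Option A} {n : ℕ} {a b : A} :
    iter g (n + 1) a = some b ↔ ∃ c, iter g n a = some c ∧ g c = some b := by
  rw [iter, Function.iterate_succ_apply', Option.bind_eq_some_iff]
  rfl

lemma IsStrings.iter_e (h : IsStrings K w ρ d) (a : A) (n : ℕ) (b : A) :
    iter K.e n a = some b ↔ ρ b = ρ a ∧ d b = d a + n := by
  induction n generalizing b with
  | zero =>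
    simp only [iter, Function.iterate_zero, id, Option.some.injEq, add_zero]
    exact ⟨by rintro rfl; exact ⟨rfl, rfl⟩, fun hb => (h.inj _ _ hb.1 hb.2).symm⟩
  | succ n ih =>
    simp only [iter_succ_eq_some, ih, h.e]
    constructor
    · rintro ⟨c, h1, h2⟩
      omega
    · rintro ⟨h1, h2⟩
      have h3 := h.d_le b
      have h4 := h.le_d a
      obtain ⟨c, hc⟩ := h.exists_eq a (d a + n) (by omega) (by omega)
      exact ⟨c, hc, by omega⟩

lemma IsStrings.iter_f (h : IsStrings K w ρ d) (a : A) (n : ℕ) (b : A) :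
    iter K.f n a = some b ↔ ρ b = ρ a ∧ d b + n = d a := by
  induction n generalizing b with
  | zero =>
    simp only [iter, Function.iterate_zero, id, Option.some.injEq, add_zero]
    exact ⟨by rintro rfl; exact ⟨rfl, rfl⟩, fun hb => (h.inj _ _ hb.1 hb.2).symm⟩
  | succ n ih =>
    simp only [iter_succ_eq_some, ih, h.f]
    constructor
    · rintro ⟨c, h1, h2⟩
      omega
    · rintro ⟨h1, h2⟩
      have h3 := h.le_d b
      have h4 := h.d_le a
      obtain ⟨c, hc⟩ := h.exists_eq a (d b + 1) (by omega) (by omega)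
      exact ⟨c, by omega, by omega⟩

lemma IsStrings.isNormal (h : IsStrings K w ρ d) : K.IsNormal where
  e_spec a b hab := by
    obtain ⟨h1, h2⟩ := (h.e a b).1 hab
    refine ⟨Prod.ext ?_ ?_, ?_, ?_⟩ <;>
      simp only [h.wt, h.φ, h.ε, h1, h2, Nat.cast_add, Nat.cast_one, Prod.fst_add, Prod.snd_add] <;>
      omega
  f_spec a b hab := by
    obtain ⟨h1, h2⟩ := (h.f a b).1 hab
    simp only [h.wt, h.φ, h.ε, h1, ← h2, Nat.cast_add, Nat.cast_one, Prod.mk_sub_mk, Prod.mk.injEq]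
    omega
  pairing a := by
    simp only [h.wt, h.φ, h.ε]
    omega
  f_iff_e a b := by
    rw [h.f, h.e]
    exact and_congr eq_comm eq_comm
  ε_eq a := by
    have h1 := h.d_le a
    have h2 := h.le_d a
    constructor
    · obtain ⟨b, hb⟩ := h.exists_eq a (d a + (w - ρ a - d a)) (by omega) (by omega)
      refine ⟨w - ρ a - d a, by rw [h.ε]; omega, ?_⟩
      rw [(h.iter_e a _ b).2 hb]
      simp
    · rintro _ ⟨n, rfl, hn⟩
      obtain ⟨b, hb⟩ := Option.ne_none_iff_exists'.1 hn
      have h3 := (h.iter_e a n b).1 hb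
      have h4 := h.d_le b
      rw [h.ε]
      omega
  φ_eq a := by
    have h1 := h.d_le a
    have h2 := h.le_d a
    constructor
    · obtain ⟨b, hb⟩ := h.exists_eq a (ρ a) (by omega) (by omega)
      refine ⟨d a - ρ a, by rw [h.φ]; omega, ?_⟩
      rw [(h.iter_f a _ b).2 (by omega)]
      simp
    · rintro _ ⟨n, rfl, hn⟩
      obtain ⟨b, hb⟩ := Option.ne_none_iff_exists'.1 hn
      have h3 := (h.iter_f a n b).1 hb
      have h4 := h.le_d b
      rw [h.φ]
      omega

/-- All crystal data are functions of the label and the position, so a bijection preserving these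
two numbers preserves the whole structure. -/
lemma IsStrings.isIso {L : Crystal B} {ρ' d' : B → ℕ} (h : IsStrings K w ρ d)
    (h' : IsStrings L w ρ' d') (τ : A ≃ B) (hρ : ∀ a, ρ' (τ a) = ρ a) (hd : ∀ a, d' (τ a) = d a) :
    IsIso K L τ where
  wt a := by rw [h.wt, h'.wt, hd]
  ε a := by rw [h.ε, h'.ε, hd, hρ]
  φ a := by rw [h.φ, h'.φ, hd, hρ]
  e a := by
    ext b
    obtain ⟨b, rfl⟩ := τ.surjective b
    rw [h'.e, hρ, hρ, hd, hd, ← h.e]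
    simp
  f a := by
    ext b
    obtain ⟨b, rfl⟩ := τ.surjective b
    rw [h'.f, hρ, hρ, hd, hd, ← h.f]
    simp

/-- The tensor product rule asks which term attains `min (w2 + r1 - d') (d + r2)`. When `ε ≤ φ` it
is the first, which does not involve `d`, so `e` may raise `d`; otherwise the first term is strictly
larger and `e` may raise `d'`. Either way the label is unchanged, and dually for `f`. -/
lemma IsStrings.tensor {L : Crystal B} {w1 r1 w2 r2 : ℕ} {d' : B → ℕ}
    (h : IsStrings K w1 (fun _ => r1) d) (h' : IsStrings L w2 (fun _ => r2) d') :
    IsStrings (K.tensor L) (w1 + w2) (fun p => genericRank r1 w2 r2 (d p.1, d' p.2))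
      (fun p => d p.1 + d' p.2) where
  inj p q h1 h2 := by
    have a1 := h.le_d p.1; have a2 := h.d_le p.1; have a3 := h'.le_d p.2; have a4 := h'.d_le p.2
    have b1 := h.le_d q.1; have b2 := h.d_le q.1; have b3 := h'.le_d q.2; have b4 := h'.d_le q.2
    simp only [genericRank] at h1 h2
    exact Prod.ext (h.inj _ _ rfl (by omega)) (h'.inj _ _ rfl (by omega))
  le_d p := by
    have a1 := h.le_d p.1; have a2 := h.d_le p.1; have a3 := h'.le_d p.2; have a4 := h'.d_le p.2
    simp only [genericRank]
    omega
  d_le p := by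
    have a1 := h.le_d p.1; have a2 := h.d_le p.1; have a3 := h'.le_d p.2; have a4 := h'.d_le p.2
    simp only [genericRank]
    omega
  exists_eq p k h1 h2 := by
    have a1 := h.le_d p.1; have a2 := h.d_le p.1; have a3 := h'.le_d p.2; have a4 := h'.d_le p.2
    simp only [genericRank] at h1 h2 ⊢
    set ρ := min (w2 + r1 - d' p.2) (d p.1 + r2)
    -- The first position is found by solving label `ρ` and total `k` for it, as in
    -- `exists_admissible_of_T2vr_nonempty`.
    obtain ⟨a, -, ha⟩ := h.exists_eq p.1 (max (ρ + k - (w2 + r1)) (ρ - r2)) (by omega) (by omega)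
    obtain ⟨b, -, hb⟩ := h'.exists_eq p.2 (k - max (ρ + k - (w2 + r1)) (ρ - r2)) (by omega)
      (by omega)
    refine ⟨(a, b), ?_⟩
    simp only [ha, hb]
    omega
  wt p := by
    simp only [Crystal.tensor, h.wt, h'.wt, Prod.mk_add_mk, Prod.mk.injEq]
    omega
  ε p := by
    have a1 := h.le_d p.1; have a2 := h.d_le p.1; have a3 := h'.le_d p.2; have a4 := h'.d_le p.2
    simp only [Crystal.tensor, h.ε, h'.ε, h.φ, genericRank]
    omega
  φ p := by
    have a1 := h.le_d p.1; have a2 := h.d_le p.1; have a3 := h'.le_d p.2; have a4 := h'.d_le p.2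
    simp only [Crystal.tensor, h.φ, h'.ε, h'.φ, genericRank]
    omega
  e p q := by
    have a1 := h.le_d p.1; have a2 := h.d_le p.1; have a3 := h'.le_d p.2; have a4 := h'.d_le p.2
    have b1 := h.le_d q.1; have b2 := h.d_le q.1; have b3 := h'.le_d q.2; have b4 := h'.d_le q.2
    obtain ⟨q1, q2⟩ := q
    simp only [Crystal.tensor, h.φ, h'.ε, genericRank] at a1 a2 a3 a4 b1 b2 b3 b4 ⊢
    split_ifs with hc
    · simp only [Option.map_eq_some_iff, h.e, Prod.mk.injEq]
      constructor
      · rintro ⟨a, ⟨-, h1⟩, rfl, rfl⟩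
        omega
      · rintro ⟨h1, h2⟩
        exact ⟨q1, ⟨trivial, by omega⟩, rfl, h'.inj _ _ rfl (by omega)⟩
    · simp only [Option.map_eq_some_iff, h'.e, Prod.mk.injEq]
      constructor
      · rintro ⟨a, ⟨-, h1⟩, rfl, rfl⟩
        omega
      · rintro ⟨h1, h2⟩
        exact ⟨q2, ⟨trivial, by omega⟩, h.inj _ _ rfl (by omega), rfl⟩
  f p q := by
    have a1 := h.le_d p.1; have a2 := h.d_le p.1; have a3 := h'.le_d p.2; have a4 := h'.d_le p.2
    have b1 := h.le_d q.1; have b2 := h.d_le q.1; have b3 := h'.le_d q.2; have b4 := h'.d_le q.2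
    obtain ⟨q1, q2⟩ := q
    simp only [Crystal.tensor, h.φ, h'.ε, genericRank] at a1 a2 a3 a4 b1 b2 b3 b4 ⊢
    split_ifs with hc
    · simp only [Option.map_eq_some_iff, h.f, Prod.mk.injEq]
      constructor
      · rintro ⟨a, ⟨-, h1⟩, rfl, rfl⟩
        omega
      · rintro ⟨h1, h2⟩
        exact ⟨q1, ⟨trivial, by omega⟩, rfl, h'.inj _ _ rfl (by omega)⟩
    · simp only [Option.map_eq_some_iff, h'.f, Prod.mk.injEq]
      constructor
      · rintro ⟨a, ⟨-, h1⟩, rfl, rfl⟩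
        omega
      · rintro ⟨h1, h2⟩
        exact ⟨q2, ⟨trivial, by omega⟩, h.inj _ _ rfl (by omega), rfl⟩

/-- A direct sum over `ρ` of strings with label `ρ`, with one trivial crystal with at most one
element as an additional factor of each. -/
lemma IsStrings.directSum_triv_tensor {w : ℕ} {S M : ℕ → Type} {K : ∀ r, Crystal (M r)}
    {d : ∀ r, M r → ℕ} [∀ r, Subsingleton (S r)] (h : ∀ r, IsStrings (K r) w (fun _ => r) (d r)) :
    IsStrings (directSum fun r => (triv (S r)).tensor (K r)) w (fun p => p.1)
      (fun p => d p.1 p.2.2) where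
  inj := by
    rintro ⟨r, s, m⟩ ⟨r', s', m'⟩ h1 h2
    simp only at h1
    subst h1
    obtain rfl := Subsingleton.elim s s'
    obtain rfl := (h r).inj m m' rfl h2
    rfl
  le_d p := (h p.1).le_d p.2.2
  d_le p := (h p.1).d_le p.2.2
  exists_eq p k h1 h2 := by
    obtain ⟨b, -, hb⟩ := (h p.1).exists_eq p.2.2 k h1 h2
    exact ⟨⟨p.1, p.2.1, b⟩, rfl, hb⟩
  wt p := by
    simp [directSum, Crystal.tensor, triv, (h p.1).wt]
  ε p := by
    have h1 := (h p.1).d_le p.2.2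
    simp only [directSum, Crystal.tensor, triv, (h p.1).ε]
    omega
  φ p := by
    have h1 := (h p.1).d_le p.2.2
    simp only [directSum, Crystal.tensor, triv, (h p.1).ε, (h p.1).φ]
    omega
  e := by
    rintro ⟨r, s, m⟩ ⟨r', s', m'⟩
    have h1 := (h r).d_le m
    simp only [directSum, Crystal.tensor, triv, (h r).ε, Option.map_eq_some_iff]
    constructor
    · rintro ⟨⟨s₁, m₁⟩, h2, h3⟩
      cases h3
      split_ifs at h2
      · simp at h2
      · obtain ⟨b, hb, hb'⟩ := Option.map_eq_some_iff.1 h2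
        cases hb'
        exact ⟨rfl, ((h r).e m _).1 hb |>.2⟩
    · rintro ⟨rfl, h2⟩
      have h3 := (h r').d_le m'
      obtain rfl := Subsingleton.elim s s'
      refine ⟨(s, m'), ?_, rfl⟩
      -- A successor `m'` exists, so `ε` of `m` is positive and the operator acts on the second
      -- factor.
      rw [if_neg (by omega), ((h r').e m m').2 ⟨rfl, h2⟩]
      rfl
  f := by
    rintro ⟨r, s, m⟩ ⟨r', s', m'⟩
    have h1 := (h r).d_le m
    simp only [directSum, Crystal.tensor, triv, (h r).ε, Option.map_eq_some_iff]
    -- Since `ε` is nonnegative and `φ` of the trivial factor is zero, `f` never acts on the trivial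
    -- factor.
    rw [if_neg (by omega)]
    constructor
    · rintro ⟨⟨s₁, m₁⟩, h2, h3⟩
      cases h3
      obtain ⟨b, hb, hb'⟩ := Option.map_eq_some_iff.1 h2
      cases hb'
      exact ⟨rfl, ((h r).f m _).1 hb |>.2⟩
    · rintro ⟨rfl, h2⟩
      obtain rfl := Subsingleton.elim s s'
      refine ⟨(s, m'), ?_, rfl⟩
      rw [((h r').f m m').2 ⟨rfl, h2⟩]
      rfl

end Crystal

end Strings

/-! ### Components and crystal structure of the fibres over a nilpotent operator. -/

section M2

variable {v w r : ℕ} {s : End ℂ (Vec w)}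

lemma vdim_M2v (h : (M2v v w r s).Nonempty) : vdim (M2v v w r s) = v := by
  have : (fun F : Gr w => finrank ℂ F) '' M2v v w r s = {v} := by
    obtain ⟨F, hF⟩ := h
    refine Set.Subset.antisymm ?_ ?_
    · rintro _ ⟨F', hF', rfl⟩
      exact hF'.2
    · rintro _ rfl
      exact ⟨F, hF, hF.2⟩
  rw [vdim, this, csInf_singleton]

lemma le_finrank_of_mem_M2 {F : Gr w} (h : F ∈ M2 w r s) :
    r ≤ finrank ℂ F ∧ finrank ℂ F + r ≤ w := by
  obtain ⟨h1, h2⟩ := h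
  have h3 := Submodule.finrank_mono h2.2.1
  have h4 := Submodule.finrank_mono h2.2.2
  have h5 := s.finrank_range_add_finrank_ker
  rw [finrank_fin_fun] at h5
  have h6 := h1.2
  simp only at h3 h4
  omega

/-- Operators of rank `r` with square zero are conjugate. -/
lemma exists_equiv_conj_of_mem_O2 {t t' : End ℂ (Vec w)} (ht : t ∈ O2 w r) (ht' : t' ∈ O2 w r) :
    ∃ Ψ : Vec w ≃ₗ[ℂ] Vec w, ∀ x, Ψ (t x) = (1 : ℂ) • t' (Ψ x) := by
  obtain ⟨Ψ, hΨ, -⟩ := exists_equiv_conj_of_mem_M2 (F := LinearMap.range t)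
    (F' := LinearMap.range t') ⟨ht, ht.1, le_rfl, range_le_ker_of_mem_N2 ht.1⟩
    ⟨ht', ht'.1, le_rfl, range_le_ker_of_mem_N2 ht'.1⟩ (ht.2.trans ht'.2.symm)
  exact ⟨Ψ, fun x => by rw [hΨ, one_smul]⟩

lemma M2v_nonempty_iff (hs : IsBasePoint w r s) :
    (M2v v w r s).Nonempty ↔ r ≤ v ∧ v + r ≤ w := by
  constructor
  · rintro ⟨F, hF, rfl⟩
    exact le_finrank_of_mem_M2 hF
  · rintro ⟨h1, h2⟩
    -- Existence is read off from the tensor product variety with zero second factor; the point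
    -- found is then conjugated to the base point.
    obtain ⟨x, hx, hx'⟩ := exists_mem_T2vv_inter_T2vr (w1 := w) (r1 := r) (w2 := 0) (r2 := 0)
      (v := (v, 0)) ⟨h1, h2, le_rfl, le_rfl⟩
    have h3 : genericRank r 0 0 (v, 0) = r := by
      simp only [genericRank]
      omega
    rw [h3] at hx'
    have hO : x.t ∈ O2 w r := hx'.2.2
    have hs' := hs ⟨_, hO⟩
    obtain ⟨Ψ, hΨ⟩ := exists_equiv_conj_of_mem_O2 hO hs'
    refine ⟨_, ⟨hs', mem_M2tot_of_conj hx'.1.1 one_ne_zero hΨ⟩, ?_⟩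
    rw [LinearEquiv.finrank_map_eq]
    exact hx'.2.1

/-- The dimension is locally constant, so the nonempty irreducible pieces are relatively closed and
none lies in the closure of another. -/
lemma components_M2 (hs : IsBasePoint w r s) :
    components (M2 w r s) = {C | ∃ v, r ≤ v ∧ v + r ≤ w ∧ C = M2v v w r s} := by
  have hfin : Finite {v : ℕ // r ≤ v ∧ v + r ≤ w} :=
    Set.Finite.to_subtype ((Set.finite_Iic w).subset fun v hv => by
      have := hv.2
      simp only [Set.mem_Iic]
      omega)
  have hcl : ∀ v, closure (M2v v w r s) ⊆ {F | finrank ℂ F = v} := fun v =>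
    closure_minimal (fun F hF => hF.2) (isOpen_compl_iff.1 (isOpen_gr_finrank (¬ · = v)))
  rw [components_eq_range (A := fun v : {v : ℕ // r ≤ v ∧ v + r ≤ w} => M2v v.1 w r s)]
  · ext C
    have h1 : ∀ v, closure (M2v v w r s) ∩ M2 w r s = M2v v w r s := fun v =>
      Set.Subset.antisymm (fun F hF => ⟨hF.2, hcl v hF.1⟩)
        (fun F hF => ⟨subset_closure hF, hF.1⟩)
    simp only [h1, Set.mem_range, Subtype.exists, Set.mem_ofPred_eq]
    exact exists_congr fun v => ⟨fun ⟨h, h'⟩ => ⟨h.1, h.2, h'.symm⟩,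
      fun ⟨h, h', h''⟩ => ⟨⟨h, h'⟩, h''.symm⟩⟩
  · ext F
    simp only [Set.mem_iUnion]
    exact ⟨fun hF => ⟨⟨finrank ℂ F, le_finrank_of_mem_M2 hF⟩, hF, rfl⟩, fun ⟨_, hv⟩ => hv.1⟩
  · exact fun v => ⟨(M2v_nonempty_iff hs).2 v.2, isPreirreducible_M2v _ _ _ _⟩
  · intro i j hij
    obtain ⟨F, hF⟩ := (M2v_nonempty_iff hs).2 i.2
    exact Subtype.ext (hF.2.symm.trans (hcl _ (hij hF)))

lemma M2v_mem_components (hs : IsBasePoint w r s) (h1 : r ≤ v) (h2 : v + r ≤ w) :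
    M2v v w r s ∈ components (M2 w r s) := by
  rw [components_M2 hs]
  exact ⟨v, h1, h2, rfl⟩

lemma M2Comp_spec (hs : IsBasePoint w r s) (C : M2Comp w r s) :
    r ≤ vdim C.1 ∧ vdim C.1 + r ≤ w ∧ C.1 = M2v (vdim C.1) w r s := by
  obtain ⟨C, hC⟩ := C
  obtain ⟨v, h1, h2, rfl⟩ := (components_M2 hs).subset hC
  simp only
  rw [vdim_M2v ((M2v_nonempty_iff hs).2 ⟨h1, h2⟩)]
  exact ⟨h1, h2, rfl⟩

lemma M2Comp_ext (hs : IsBasePoint w r s) {C D : M2Comp w r s} (h : vdim C.1 = vdim D.1) : C = D :=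
  Subtype.ext (by rw [(M2Comp_spec hs C).2.2, (M2Comp_spec hs D).2.2, h])

lemma exists_M2Comp (hs : IsBasePoint w r s) (h1 : r ≤ v) (h2 : v + r ≤ w) :
    ∃ C : M2Comp w r s, vdim C.1 = v :=
  ⟨⟨_, M2v_mem_components hs h1 h2⟩, vdim_M2v ((M2v_nonempty_iff hs).2 ⟨h1, h2⟩)⟩

lemma isStrings_M2Crystal (hs : IsBasePoint w r s) :
    (M2Crystal w r s).IsStrings w (fun _ => r) (fun C => vdim C.1) where
  inj C D _ h := M2Comp_ext hs h
  le_d C := (M2Comp_spec hs C).1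
  d_le C := (M2Comp_spec hs C).2.1
  exists_eq C k h1 h2 := by
    obtain ⟨D, hD⟩ := exists_M2Comp hs h1 h2
    exact ⟨D, rfl, hD⟩
  wt C := rfl
  ε C := rfl
  φ C := rfl
  e C D := by
    have hC := M2Comp_spec hs C
    have hD := M2Comp_spec hs D
    simp only [M2Crystal, true_and]
    constructor
    · intro h
      split_ifs at h with h1
      rw [← Option.some.inj h]
      exact vdim_M2v ((M2v_nonempty_iff hs).2 (by omega))
    · intro h
      have h1 : M2v (vdim C.1 + 1) w r s = D.1 := by rw [hD.2.2, h]
      rw [dif_pos ⟨by omega, h1 ▸ D.2⟩]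
      exact congrArg some (Subtype.ext h1)
  f C D := by
    have hC := M2Comp_spec hs C
    have hD := M2Comp_spec hs D
    simp only [M2Crystal, true_and]
    constructor
    · intro h
      split_ifs at h with h1
      rw [← Option.some.inj h]
      simp only
      rw [vdim_M2v ((M2v_nonempty_iff hs).2 (by omega))]
      omega
    · intro h
      have h1 : M2v (vdim C.1 - 1) w r s = D.1 := by rw [hD.2.2, ← h, Nat.add_sub_cancel]
      rw [dif_pos ⟨by omega, h1 ▸ D.2⟩]
      exact congrArg some (Subtype.ext h1)

end M2

/-! ### Irreducibility and nonemptiness of the Spaltenstein variety. -/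

section S2

variable {w1 r1 w2 r2 r : ℕ} {t : End ℂ (Vec (w1 + w2))}

lemma S2_nonempty_iff (ht : IsBasePoint (w1 + w2) r t) : (S2 w1 r1 w2 r2 r t).Nonempty ↔
    r1 + r2 ≤ r ∧ r + r2 ≤ w2 + r1 ∧ r + r1 ≤ w1 + r2 := by
  constructor
  · rintro ⟨X, hX, hc⟩
    have h1 := invariants_le (F := LinearMap.range t) rfl le_rfl (range_le_ker_of_mem_N2 hX.1) hc
    rw [hX.2] at h1
    omega
  · rintro ⟨h1, h2, h3⟩
    -- A point with `v = r` and rank `r` is sought, that is, with `F = im t`; the pair `(v¹, v²)` is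
    -- the one determined by these two numbers.
    obtain ⟨x, hx, hx'⟩ := exists_mem_T2vv_inter_T2vr (w1 := w1) (r1 := r1) (w2 := w2) (r2 := r2)
      (v := (max (r + r - (w2 + r1)) (r - r2), r - max (r + r - (w2 + r1)) (r - r2)))
      (by simp only [Admissible]; omega)
    have h4 : genericRank r1 w2 r2
        (max (r + r - (w2 + r1)) (r - r2), r - max (r + r - (w2 + r1)) (r - r2)) = r := by
      simp only [genericRank]
      omega
    rw [h4] at hx'
    have hO := hx'.2.2
    have ht' := ht ⟨_, hO⟩
    obtain ⟨Ψ, hΨ⟩ := exists_equiv_conj_of_mem_O2 hO ht'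
    exact ⟨_, ht', hx.1.2.conj one_ne_zero hΨ⟩

lemma components_S2 (h : (S2 w1 r1 w2 r2 r t).Nonempty) :
    components (S2 w1 r1 w2 r2 r t) = {S2 w1 r1 w2 r2 r t} := by
  rw [components_eq_range (A := fun _ : Unit => S2 w1 r1 w2 r2 r t)
    (Set.iUnion_const _).symm
    (fun _ => ⟨h, isPreirreducible_S2 _ _ _ _ _ _⟩) (fun _ _ _ => rfl)]
  simp [Set.range_const, Set.inter_eq_right.2 subset_closure]

lemma nonempty_of_mem_components {α : Type} [TopologicalSpace α] {S C : Set α}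
    (h : C ∈ components S) : S.Nonempty :=
  (mem_components_iff.1 h).1.2.1.mono (mem_components_iff.1 h).1.1

lemma eq_S2_of_mem_components (C : S2Comp w1 r1 w2 r2 r t) : C.1 = S2 w1 r1 w2 r2 r t :=
  (components_S2 (nonempty_of_mem_components C.2)).subset C.2

instance : Subsingleton (S2Comp w1 r1 w2 r2 r t) :=
  ⟨fun C D => Subtype.ext ((eq_S2_of_mem_components C).trans (eq_S2_of_mem_components D).symm)⟩

end S2

/-! ### Components of the tensor product variety. -/

section T2

variable {w1 r1 w2 r2 : ℕ}

lemma components_T2 : components (T2 w1 r1 w2 r2) =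
    Set.range fun v : {v // Admissible w1 r1 w2 r2 v} =>
      closure (T2vv v.1.1 w1 r1 v.1.2 w2 r2) ∩ T2 w1 r1 w2 r2 := by
  have hfin : Finite {v // Admissible w1 r1 w2 r2 v} :=
    Set.Finite.to_subtype (((Set.finite_Iic w1).prod (Set.finite_Iic w2)).subset fun v hv => by
      obtain ⟨h1, h2, h3, h4⟩ := hv
      simp only [Set.mem_prod, Set.mem_Iic]
      omega)
  refine components_eq_range ?_ ?_ ?_
  · ext x
    simp only [Set.mem_iUnion]
    constructor
    · intro hx
      have h1 := Submodule.finrank_mono (inf_le_left : x.F ⊓ x.X ≤ x.F)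
      have h2 : x ∈ T2vv (finrank ℂ (x.F ⊓ x.X : Gr (w1 + w2))) w1 r1
          (finrank ℂ x.F - finrank ℂ (x.F ⊓ x.X : Gr (w1 + w2))) w2 r2 :=
        mem_T2vv_iff.2 ⟨hx, rfl, by omega⟩
      exact ⟨⟨_, (admissible_of_mem_T2vv h2).1⟩, h2⟩
    · rintro ⟨_, hx⟩
      exact hx.1
  · rintro ⟨v, hv⟩
    refine ⟨(exists_mem_T2vv_inter_T2vr hv).mono Set.inter_subset_left, isPreirreducible_T2vv ?_ ?_⟩
    · exact (Nat.le_add_right _ _).trans hv.2.1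
    · exact (Nat.le_add_right _ _).trans hv.2.2.2
  · exact fun v v' h => Subtype.ext (eq_of_T2vv_subset_closure v.2 v'.2 h)

lemma eq_of_closure_T2vv_inter_eq {v v' : ℕ × ℕ} (h : Admissible w1 r1 w2 r2 v)
    (h' : Admissible w1 r1 w2 r2 v')
    (heq : closure (T2vv v.1 w1 r1 v.2 w2 r2) ∩ T2 w1 r1 w2 r2 =
      closure (T2vv v'.1 w1 r1 v'.2 w2 r2) ∩ T2 w1 r1 w2 r2) : v = v' :=
  eq_of_T2vv_subset_closure h h' fun _ hx => (heq.subset ⟨subset_closure hx, hx.1⟩).1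

end T2

/-! ### The two labelings of these components. -/

section Labelings

variable {w1 r1 w2 r2 : ℕ} {t1 : End ℂ (Vec w1)} {t2 : End ℂ (Vec w2)}
  {t : ℕ → End ℂ (Vec (w1 + w2))}

lemma admissible_vdim (ht1 : IsBasePoint w1 r1 t1) (ht2 : IsBasePoint w2 r2 t2)
    (p : M2Comp w1 r1 t1 × M2Comp w2 r2 t2) :
    Admissible w1 r1 w2 r2 (vdim p.1.1, vdim p.2.1) :=
  ⟨(M2Comp_spec ht1 p.1).1, (M2Comp_spec ht1 p.1).2.1, (M2Comp_spec ht2 p.2).1,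
    (M2Comp_spec ht2 p.2).2.1⟩

lemma exists_equiv_T2vv (ht1 : IsBasePoint w1 r1 t1) (ht2 : IsBasePoint w2 r2 t2) :
    ∃ α : M2Comp w1 r1 t1 × M2Comp w2 r2 t2 ≃ T2Comp w1 r1 w2 r2,
      ∀ p, (α p : Set (Triple (w1 + w2))) =
        closure (T2vv (vdim p.1.1) w1 r1 (vdim p.2.1) w2 r2) ∩ T2 w1 r1 w2 r2 := by
  let α (p : M2Comp w1 r1 t1 × M2Comp w2 r2 t2) : T2Comp w1 r1 w2 r2 :=
    ⟨closure (T2vv (vdim p.1.1) w1 r1 (vdim p.2.1) w2 r2) ∩ T2 w1 r1 w2 r2, by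
      rw [components_T2]
      exact ⟨⟨_, admissible_vdim ht1 ht2 p⟩, rfl⟩⟩
  refine ⟨Equiv.ofBijective α ⟨fun p q h => ?_, fun C => ?_⟩, fun p => rfl⟩
  · have := eq_of_closure_T2vv_inter_eq (admissible_vdim ht1 ht2 p) (admissible_vdim ht1 ht2 q)
      (congrArg Subtype.val h)
    rw [Prod.mk.injEq] at this
    exact Prod.ext (M2Comp_ext ht1 this.1) (M2Comp_ext ht2 this.2)
  · obtain ⟨⟨v, hv⟩, hC⟩ := components_T2.subset C.2
    obtain ⟨C1, h1⟩ := exists_M2Comp ht1 hv.1 hv.2.1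
    obtain ⟨C2, h2⟩ := exists_M2Comp ht2 hv.2.2.1 hv.2.2.2
    refine ⟨(C1, C2), Subtype.ext ?_⟩
    simp only [α, h1, h2]
    exact hC

lemma exists_admissible_of_comp (ht : ∀ r, IsBasePoint (w1 + w2) r (t r))
    (q : Σ r : ℕ, S2Comp w1 r1 w2 r2 r (t r) × M2Comp (w1 + w2) r (t r)) :
    ∃ p, Admissible w1 r1 w2 r2 p ∧ p.1 + p.2 = vdim q.2.2.1 ∧ genericRank r1 w2 r2 p = q.1 := by
  apply exists_admissible_of_T2vr_nonempty
  -- Both factors live over the same operator `t q.1`, so any `X` from the first and any `F` from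
  -- the second combine to a triple in the stratum.
  obtain ⟨X, hX⟩ := nonempty_of_mem_components q.2.1.2
  have h1 := M2Comp_spec (ht q.1) q.2.2
  obtain ⟨F, hF⟩ := (M2v_nonempty_iff (ht q.1)).2 ⟨h1.1, h1.2.1⟩
  exact ⟨⟨t q.1, X, F⟩, ⟨hF.1.2, hX.2⟩, hF.2, hX.1⟩

lemma exists_equiv_T2vr (ht : ∀ r, IsBasePoint (w1 + w2) r (t r)) :
    ∃ β : (Σ r : ℕ, S2Comp w1 r1 w2 r2 r (t r) × M2Comp (w1 + w2) r (t r)) ≃ T2Comp w1 r1 w2 r2,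
      ∀ q, (β q : Set (Triple (w1 + w2))) =
        closure (T2vr (vdim q.2.2.1) w1 r1 w2 r2 q.1) ∩ T2 w1 r1 w2 r2 := by
  let β (q : Σ r : ℕ, S2Comp w1 r1 w2 r2 r (t r) × M2Comp (w1 + w2) r (t r)) :
      T2Comp w1 r1 w2 r2 :=
    ⟨closure (T2vr (vdim q.2.2.1) w1 r1 w2 r2 q.1) ∩ T2 w1 r1 w2 r2, by
      obtain ⟨p, h1, h2, h3⟩ := exists_admissible_of_comp ht q
      rw [components_T2, ← h2, ← h3, ← closure_T2vv_eq h1]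
      exact ⟨⟨p, h1⟩, rfl⟩⟩
  refine ⟨Equiv.ofBijective β ⟨fun q q' h => ?_, fun C => ?_⟩, fun p => rfl⟩
  · obtain ⟨p, h1, h2, h3⟩ := exists_admissible_of_comp ht q
    obtain ⟨p', h1', h2', h3'⟩ := exists_admissible_of_comp ht q'
    have h4 := congrArg Subtype.val h
    simp only [β] at h4
    rw [← h2, ← h3, ← h2', ← h3', ← closure_T2vv_eq h1, ← closure_T2vv_eq h1'] at h4
    have h5 := eq_of_closure_T2vv_inter_eq h1 h1' h4
    subst h5
    -- Equal closures give equal rank and equal `dim F`; injectivity of the label and position on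
    -- the direct sum then identifies the elements.
    exact (Crystal.IsStrings.directSum_triv_tensor
      (S := fun r => S2Comp w1 r1 w2 r2 r (t r)) fun r => isStrings_M2Crystal (ht r)).inj q q'
      (h3.symm.trans h3') (h2.symm.trans h2')
  · obtain ⟨⟨v, hv⟩, hC⟩ := components_T2.subset C.2
    obtain ⟨v1, v2⟩ := v
    have h1 := hv
    simp only [Admissible] at h1
    obtain ⟨M, hM⟩ := exists_M2Comp (ht (genericRank r1 w2 r2 (v1, v2))) (v := v1 + v2)
      (by simp only [genericRank]; omega) (by simp only [genericRank]; omega)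
    have hS : (S2 w1 r1 w2 r2 _ (t (genericRank r1 w2 r2 (v1, v2)))).Nonempty :=
      (S2_nonempty_iff (ht _)).2 (by simp only [genericRank]; omega)
    refine ⟨⟨_, ⟨_, (components_S2 hS).superset rfl⟩, M⟩, Subtype.ext ?_⟩
    simp only [β, hM]
    rw [← hC]
    exact congrArg (· ∩ T2 w1 r1 w2 r2) (closure_T2vv_eq hv).symm

end Labelings

end GL2Tensor

end

/-! ### The theorem. -/

open GL2Tensor
theorem mainTheorem2 (w1 r1 w2 r2 : ℕ)
    (t1 : Module.End ℂ (Vec w1)) (ht1 : IsBasePoint w1 r1 t1)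
    (t2 : Module.End ℂ (Vec w2)) (ht2 : IsBasePoint w2 r2 t2)
    (t : ℕ → Module.End ℂ (Vec (w1 + w2))) (ht : ∀ r, IsBasePoint (w1 + w2) r (t r)) :
    -- the irreducible components of `𝔐₂(w,r)` are the pieces `𝔐₂(v,w,r)`, `r ≤ v ≤ w - r`,
    -- which are nonempty, and these components form a normal crystal
    (∀ (w r : ℕ) (s : Module.End ℂ (Vec w)), IsBasePoint w r s →
      components (M2 w r s) = {C | ∃ v, r ≤ v ∧ v + r ≤ w ∧ C = M2v v w r s} ∧
      (∀ v, (M2v v w r s).Nonempty ↔ r ≤ v ∧ v + r ≤ w) ∧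
      (M2Crystal w r s).IsNormal) ∧
    -- the Spaltenstein variety is irreducible or empty
    (∀ r : ℕ,
      ((r1 + r2 ≤ r ∧ (r : ℤ) ≤ min ((w2 : ℤ) - r2 + r1) ((w1 : ℤ) - r1 + r2)) →
        components (S2 w1 r1 w2 r2 r (t r)) = {S2 w1 r1 w2 r2 r (t r)}) ∧
      (¬ (r1 + r2 ≤ r ∧ (r : ℤ) ≤ min ((w2 : ℤ) - r2 + r1) ((w1 : ℤ) - r1 + r2)) →
        components (S2 w1 r1 w2 r2 r (t r)) = ∅)) ∧
    ((M2Crystal w1 r1 t1).tensor (M2Crystal w2 r2 t2)).IsNormal ∧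
    (sumCrystal w1 r1 w2 r2 t).IsNormal ∧
    -- the two labelings of the irreducible components of the tensor product variety
    ∃ (α : M2Comp w1 r1 t1 × M2Comp w2 r2 t2 ≃ T2Comp w1 r1 w2 r2)
      (β : (Σ r : ℕ, S2Comp w1 r1 w2 r2 r (t r) × M2Comp (w1 + w2) r (t r)) ≃
        T2Comp w1 r1 w2 r2),
      (∀ p, (α p : Set (Triple (w1 + w2))) =
        closure (T2vv (vdim p.1.1) w1 r1 (vdim p.2.1) w2 r2) ∩ T2 w1 r1 w2 r2) ∧
      (∀ q, (β q : Set (Triple (w1 + w2))) =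
        closure (T2vr (vdim q.2.2.1) w1 r1 w2 r2 q.1) ∩ T2 w1 r1 w2 r2) ∧
      -- the formula for `τ₂ = β⁻¹ ∘ α`
      (∀ (v1 v2 : ℕ) (h1 : M2v v1 w1 r1 t1 ∈ components (M2 w1 r1 t1))
        (h2 : M2v v2 w2 r2 t2 ∈ components (M2 w2 r2 t2)),
        let q := (α.trans β.symm) (⟨_, h1⟩, ⟨_, h2⟩)
        (q.1 : ℤ) = min ((w2 : ℤ) - v2 + r1) ((v1 : ℤ) + r2) ∧
        (q.2.1 : Set (Gr (w1 + w2))) = S2 w1 r1 w2 r2 q.1 (t q.1) ∧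
        (q.2.2 : Set (Gr (w1 + w2))) = M2v (v1 + v2) (w1 + w2) q.1 (t q.1)) ∧
      -- `τ₂` is a crystal isomorphism
      Crystal.IsIso ((M2Crystal w1 r1 t1).tensor (M2Crystal w2 r2 t2))
        (sumCrystal w1 r1 w2 r2 t) (α.trans β.symm) := by
  have K1 := isStrings_M2Crystal ht1
  have K2 := isStrings_M2Crystal ht2
  have hT := K1.tensor K2
  have hS := Crystal.IsStrings.directSum_triv_tensor
    (S := fun r => S2Comp w1 r1 w2 r2 r (t r)) fun r => isStrings_M2Crystal (ht r)
  refine ⟨fun w r s hs => ⟨components_M2 hs, fun v => M2v_nonempty_iff hs,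
    (isStrings_M2Crystal hs).isNormal⟩, fun r => ⟨fun h => ?_, fun h => ?_⟩, hT.isNormal,
    hS.isNormal, ?_⟩
  · exact components_S2 ((S2_nonempty_iff (ht r)).2 (by omega))
  · refine Set.eq_empty_of_forall_notMem fun C hC => h ?_
    have := (S2_nonempty_iff (ht r)).1 (nonempty_of_mem_components hC)
    omega
  obtain ⟨α, hα⟩ := exists_equiv_T2vv ht1 ht2
  obtain ⟨β, hβ⟩ := exists_equiv_T2vr (r1 := r1) (r2 := r2) ht
  -- A component has the form of a closure of a `(v¹, v²)`-stratum for only one admissible pair, so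
  -- rewriting the `β`-side as such a closure identifies its rank and dimension.
  have key : ∀ p, genericRank r1 w2 r2 (vdim p.1.1, vdim p.2.1) = (β.symm (α p)).1 ∧
      vdim p.1.1 + vdim p.2.1 = vdim (β.symm (α p)).2.2.1 := fun p => by
    have h1 : β (β.symm (α p)) = α p := β.apply_symm_apply _
    have h2 := (hβ _).symm.trans ((congrArg Subtype.val h1).trans (hα p))
    obtain ⟨p', h3, h4, h5⟩ := exists_admissible_of_comp ht (β.symm (α p))
    rw [← h4, ← h5, ← closure_T2vv_eq h3] at h2
    have h6 := eq_of_closure_T2vv_inter_eq h3 (admissible_vdim ht1 ht2 p) h2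
    rw [← h4, ← h5, h6]
    exact ⟨rfl, rfl⟩
  refine ⟨α, β, hα, hβ, fun v1 v2 h1 h2 => ?_, hT.isIso hS _ (fun p => (key p).1.symm)
    fun p => (key p).2.symm⟩
  intro q
  obtain ⟨k1, k2⟩ := key (⟨_, h1⟩, ⟨_, h2⟩)
  have e1 : vdim (M2v v1 w1 r1 t1) = v1 := vdim_M2v (mem_components_iff.1 h1).1.2.1
  have e2 : vdim (M2v v2 w2 r2 t2) = v2 := vdim_M2v (mem_components_iff.1 h2).1.2.1
  -- Admissibility gives `v2 ≤ w2`, which makes the truncated subtraction in `genericRank` agree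
  -- with the integer formula.
  have a := admissible_vdim ht1 ht2 (⟨_, h1⟩, ⟨_, h2⟩)
  simp only [Admissible, e1, e2] at a
  simp only [e1, e2] at k1 k2
  refine ⟨?_, eq_S2_of_mem_components _, ?_⟩
  · change ((β.symm (α (⟨_, h1⟩, ⟨_, h2⟩))).1 : ℤ) = _
    rw [← k1]
    simp only [genericRank]
    omega
  · have := (M2Comp_spec (ht q.1) q.2.2).2.2
    rw [this]
    congr 1
    exact k2.symm
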